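/- Let $n\ge 3$ and let $K\subset\mathbb R^3$ be the closed polygonal curve with (cyclically ordered) vertices $v_1,\dots,v_n$ and closed edges $e_i=[v_i,v_{i+1}]$. **Trisecants.** For $m\ge 1$, an $m$-secant line of $K$ is an oriented line $\ell$ such that $\ell\cap K$ has at least $m$ connected components. An $m$-secant of $K$ is an ordered $m$-tuple of points of $K$, no two of which lie in a common straight subarc of $K$, that lie in order on an $m$-secant line. A $3$-secant is called a trisecant and a $5$-secant a quintisecant. Let $\Delta\subset K^3$ be the big diagonal (triples in which some two points are equal) and let $\tilde\Delta\subset K^3$ be the set of triples in which some two points lie in a common straight subarc of $K$. Let $\mathcal T\subset K^3$ be the set of all trisecants, $\overline{\mathcal T}$ its closure in $K^3$, and $\partial\mathcal T:=\overline{\mathcal T}\smallsetminus\mathcal T$. **Genericity.** The osculating plane at a vertex is the plane spanned by the two edges incident to it. Assume that $K$ is generic: no three vertices are collinear, no four vertices are coplanar, and * (G1) for any three pairwise skew edges $e_i,e_j,e_k$, no vertex of $K$ other than the endpoints of these edges lies on the doubly-ruled surface generated by the lines of $e_i,e_j,e_k$ (the union of all lines that meet each of these three lines, possibly at infinity); *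 (G2) $K$ has no quintisecants and no $m$-secants with $m>5$; * (G3) no line of a trisecant that includes a vertex $w$ of $K$ lies in the osculating plane at $w$. **Degenerate trisecants.** A degenerate trisecant is a triple $(w,w,p)$ or $(p,w,w)$ in $K^3$, where $w$ is a vertex of $K$ and $p\in K$ is a point of the osculating plane at $w$ such that the line through $p$ and $w$ does not lie in the closed double wedge at $w$ (the sector of the osculating plane between the two edges incident to $w$, together with the vertically opposite sector). **Proposition.** $\overline{\mathcal T}$ is a (possibly empty) compact $1$-manifold with boundary, its manifold boundary is $\partial\mathcal T$, and it is embedded piecewise smoothly in the cubical complex $K^3=\bigcup_{i,j,k}e_i\times e_j\times e_k$: every point of $\overline{\mathcal T}\smallsetminus\partial\mathcal T$ has a neighbourhood in $\overline{\mathcal T}$ that is an embedded open arc made of two arcs that start at the point, each of them smooth up to that point with nowhere vanishing derivative and contained in a single cube; and every point of $\partial\mathcal T$ has a neighbourhood in $\overline{\mathcal T}$ that is an embedded half-open arc ending at the point, smooth up to that point with nowhere vanishing derivative and contained in a single cube. Moreover $\mathcal T\subset K^3\smallsetminus\tilde\Delta$, $\partial\mathcal T\subset\Delta$, and $\partial\mathcal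 T$ is exactly the set of degenerate trisecants. -/

import Mathlib

open scoped ContDiff Manifold

noncomputable section

namespace PolyKnot

/-- Euclidean three-space. -/
abbrev E3 : Type := EuclideanSpace ℝ (Fin 3)

/-! ### Secants of a subset of space -/

/-- `a` and `b` lie in a common straight subarc of `K` (this includes `a = b ∈ K`). -/
def InStraightSubarc (K : Set E3) (a b : E3) : Prop := segment ℝ a b ⊆ K

/-- `ℓ ∩ K` has at least `m` connected components. -/
def IsSecantLine (K : Set E3) (m : ℕ) (ℓ : AffineSubspace ℝ E3) : Prop :=
  (m : ℕ∞) ≤ ENat.card (ConnectedComponents ↥((ℓ : Set E3) ∩ K))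

/-- An `m`-secant of `K`: an ordered `m`-tuple of points of `K`, no two of them in a common straight
subarc of `K`, that lie in order on an `m`-secant line (the line through `p` and `q`, oriented from
`p` to `q`). -/
structure IsSecant (K : Set E3) {m : ℕ} (x : Fin m → E3) : Prop where
  mem : ∀ i, x i ∈ K
  not_straight : ∀ i j, i ≠ j → ¬ InStraightSubarc K (x i) (x j)
  in_order : ∃ p q : E3, p ≠ q ∧ IsSecantLine K m line[ℝ, p, q] ∧
    ∃ t : Fin m → ℝ, StrictMono t ∧ ∀ i, x i = AffineMap.lineMap p q (t i)

/-- `K³`. -/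
def cube (K : Set E3) : Set (Fin 3 → E3) := {x | ∀ i, x i ∈ K}

/-- The big diagonal of `K³`. -/
def bigDiagonal (K : Set E3) : Set (Fin 3 → E3) :=
  {x | x ∈ cube K ∧ ∃ i j, i ≠ j ∧ x i = x j}

/-- The fattened big diagonal of `K³`: some pair of points lies in a common straight subarc. -/
def fatDiagonal (K : Set E3) : Set (Fin 3 → E3) :=
  {x | x ∈ cube K ∧ ∃ i j, i ≠ j ∧ InStraightSubarc K (x i) (x j)}

/-- The set of all trisecants of `K`. -/
def trisecants (K : Set E3) : Set (Fin 3 → E3) := {x | IsSecant K x}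

/-- The closure of the set of trisecants. For closed `K` (as here) the closure in `K³` and the
closure in the ambient space are the same set. -/
def trisecantClosure (K : Set E3) : Set (Fin 3 → E3) := closure (trisecants K)

/-- The points added to the set of trisecants by taking the closure. -/
def trisecantBoundary (K : Set E3) : Set (Fin 3 → E3) := trisecantClosure K \ trisecants K

/-! ### Closed polygons -/

section Polygon

variable {n : ℕ} [NeZero n]

/-- The closed edge from vertex `i` to the next vertex (indices are cyclic). -/
def edge (v : Fin n → E3) (i : Fin n) : Set E3 := segment ℝ (v i) (v (i + 1))

/-- The line determined by an edge. -/
def edgeLine (v : Fin n → E3) (i : Fin n) : AffineSubspace ℝ E3 := line[ℝ, v i, v (i + 1)]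

/-- The closed polygonal curve with vertices `v`. -/
def curve (v : Fin n → E3) : Set E3 := ⋃ i, edge v i

/-- The cubes `e_i × e_j × e_k` whose union is `K³`. -/
def cubes (v : Fin n → E3) : Set (Set (Fin 3 → E3)) :=
  Set.range fun f : Fin 3 → Fin n => {x | ∀ m, x m ∈ edge v (f m)}

/-- The osculating plane at a vertex: the plane of the two edges incident to it. -/
def oscPlane (v : Fin n → E3) (i : Fin n) : AffineSubspace ℝ E3 :=
  affineSpan ℝ {v (i - 1), v i, v (i + 1)}

/-- The closed double wedge in the osculating plane at a vertex which is bounded by the lines of the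
two incident edges: the sector between the two edges, together with the vertically opposite one. -/
def doubleWedge (v : Fin n → E3) (i : Fin n) : Set E3 :=
  {y | ∃ s t : ℝ, 0 ≤ s * t ∧
    y = v i + s • (v (i - 1) - v i) + t • (v (i + 1) - v i)}

/-- The degenerate trisecants: triples `(w, w, p)` or `(p, w, w)` where `w` is a vertex and `p` a
point of the curve in the osculating plane at `w` such that the line through `p` and `w` does not
lie in the double wedge at `w`. -/
def degenerateTrisecants (v : Fin n → E3) : Set (Fin 3 → E3) :=
  {x | ∃ (i : Fin n) (p : E3), p ∈ curve v ∧ p ∈ oscPlane v i ∧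
    ¬ ((line[ℝ, p, v i] : AffineSubspace ℝ E3) : Set E3) ⊆ doubleWedge v i ∧
    (x = ![v i, v i, p] ∨ x = ![p, v i, v i])}

/-- No three vertices are collinear and no four are coplanar. -/
structure IsNondegenerate (v : Fin n → E3) : Prop where
  not_collinear : ∀ f : Fin 3 → Fin n, Function.Injective f →
    ¬ Collinear ℝ (Set.range fun m => v (f m))
  not_coplanar : ∀ f : Fin 4 → Fin n, Function.Injective f →
    ¬ Coplanar ℝ (Set.range fun m => v (f m))

/-- Two edges are skew if the lines they determine do not lie in a common plane. -/
def SkewEdges (v : Fin n → E3) (i j : Fin n) : Prop :=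
  ¬ Coplanar ℝ {v i, v (i + 1), v j, v (j + 1)}

/-- The doubly-ruled surface generated by three pairwise skew lines: the union of the second ruling,
that is, of all lines that meet each of the three lines, possibly at infinity. -/
def ruledSurface (L : Fin 3 → AffineSubspace ℝ E3) : Set E3 :=
  {x | ∃ y, y ≠ x ∧ ∀ m,
    (((line[ℝ, x, y] : AffineSubspace ℝ E3) : Set E3) ∩ (L m : Set E3)).Nonempty ∨
      (line[ℝ, x, y]).Parallel (L m)}

/-- Generic polygons. -/
structure IsGeneric (v : Fin n → E3) : Prop extends IsNondegenerate v where
  /-- Given three pairwise skew edges, no vertex other than their endpoints lies on the doubly-ruled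
  surface that they generate. -/
  ruled : ∀ f : Fin 3 → Fin n, (∀ a b, a ≠ b → SkewEdges v (f a) (f b)) →
    ∀ k : Fin n, (∀ a, k ≠ f a ∧ k ≠ f a + 1) → v k ∉ ruledSurface fun a => edgeLine v (f a)
  /-- There are no quintisecants or secants of higher order. -/
  no_quintisecant : ∀ m : ℕ, 5 ≤ m → ∀ x : Fin m → E3, ¬ IsSecant (curve v) x
  /-- No line of a trisecant that includes a vertex lies in the osculating plane of that vertex. -/
  vertex_trisecant : ∀ x ∈ trisecants (curve v), ∀ k : Fin n, (∃ a, x a = v k) →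
    ¬ ∀ a, x a ∈ oscPlane v k

end Polygon

/-! ### Piecewise smoothly embedded one-manifolds with boundary -/

section Manifold

variable {V : Type*} [NormedAddCommGroup V] [NormedSpace ℝ V]

/-- On the interval `s`, the path `γ` is a smooth immersion (one-sided at an endpoint of `s` that
belongs to `s`) into a single cell of the complex `cells`. -/
structure IsSmoothPiece (cells : Set (Set V)) (γ : ℝ → V) (s : Set ℝ) : Prop where
  smooth : ContDiffOn ℝ ∞ γ s
  deriv_ne : ∀ t ∈ s, derivWithin γ s t ≠ 0
  in_cell : ∃ Q ∈ cells, Set.MapsTo γ s Q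

/-- `M` is a one-manifold with boundary `B`, embedded piecewise smoothly in the complex `cells`:
a point off `B` has a neighbourhood in `M` that is an embedded open arc, made of a smooth piece on
each side of the point, and a point of `B` has a neighbourhood in `M` that is a smoothly embedded
half-open arc ending at the point. (If `M` is compact, finitely many of these arcs cover it.) -/
structure IsPiecewiseSmoothCurve (cells : Set (Set V)) (M B : Set V) : Prop where
  boundary_subset : B ⊆ M
  at_interior : ∀ x ∈ M \ B, ∃ γ : ℝ → V, γ 0 = x ∧
    Topology.IsEmbedding ((Set.Ioo (-1 : ℝ) 1).domRestrict γ) ∧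
    (∃ U, IsOpen U ∧ γ '' Set.Ioo (-1 : ℝ) 1 = M ∩ U) ∧
    IsSmoothPiece cells γ (Set.Ioc (-1 : ℝ) 0) ∧ IsSmoothPiece cells γ (Set.Ico (0 : ℝ) 1)
  at_boundary : ∀ x ∈ B, ∃ γ : ℝ → V, γ 0 = x ∧
    Topology.IsEmbedding ((Set.Ico (0 : ℝ) 1).domRestrict γ) ∧
    (∃ U, IsOpen U ∧ γ '' Set.Ico (0 : ℝ) 1 = M ∩ U) ∧
    IsSmoothPiece cells γ (Set.Ico (0 : ℝ) 1)

end Manifold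

end PolyKnot

end

/-! Three points of K form a trisecant exactly when they are collinear in order and no two of them
share an edge (`mem_trisecants_iff`): points of a line in the same component of its intersection
with K are joined by a segment of K, and a segment of K lies in one edge. What remains is incidence
geometry of the lines of edges, governed by the nonvanishing of the volumes of tetrahedra spanned by
vertices.

Interior points. Two of the three points of a trisecant are non-vertices on edges whose lines are
skew (`exists_apart`). Through every point near the remaining one passes a unique transversal of
these two lines, given by smooth rational formulas. So the trisecants nearby form a graph over a
piece of K (`trisecants_local_graph`), and this piece consists of two straight halves, which may
meet at an angle if the point is a vertex (`trisecants_openArc`).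

Boundary points. A limit of trisecants from one cube is still collinear and in order. If its points
are distinct but two share an edge, then all three lie on that edge and the cube comes from three
consecutive edges, which contains no trisecant. So the middle point has collided with an outer one
at a vertex w where two edges meet. Trisecants that meet both these edges have their third point in
the plane of the edges, and the third edge meets this plane at most once; hence the third point is a
constant p, and p lies outside the double wedge. The only freedom left is to turn the line about p.
In coordinates along the two edges this is an explicit curve `cornerArc`, smooth across the limit
point. Conversely, every such p yields an arc of trisecants (`IsCorner.halfOpenArc`), so degenerate
trisecants and boundary points coincide.

The boundary lies in the closed big diagonal, which contains no trisecant. Hence near a trisecant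
the closure adds nothing, and the two local pictures together describe the whole closure. Triangles,
where the index arithmetic for four distinct vertices breaks down, have no trisecants and no
degenerate ones. -/

open scoped ContDiff Manifold

noncomputable section

namespace PolyKnot

/-! ### Charts from arcs, and arcs parametrized by a linear functional -/

section Arcs

/-- A relatively open embedded arc in `M`, together with an open embedding of its parameter domain
into the half-line, gives a chart of `M`. -/
lemma exists_chart_of_arc {V : Type*} [TopologicalSpace V] {M : Set V} {γ : ℝ → V} {S : Set ℝ}
    {g : S → EuclideanHalfSpace 1}
    (hg : Topology.IsOpenEmbedding g) (hγ : Topology.IsEmbedding (S.domRestrict γ))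
    (hU : ∃ U, IsOpen U ∧ γ '' S = M ∩ U) (x : M) (t : S) (hx : γ t = x) :
    ∃ e : OpenPartialHomeomorph M (EuclideanHalfSpace 1), x ∈ e.source ∧ e x = g t := by
  obtain ⟨U, hUo, hU⟩ := hU
  have hM : ∀ s : S, γ s ∈ M := fun s => (hU.subset ⟨s, s.2, rfl⟩).1
  let f : S → M := fun s => ⟨γ s, hM s⟩
  have hf : Topology.IsOpenEmbedding f := by
    refine ⟨?_, ?_⟩
    · refine Topology.IsEmbedding.of_comp ?_ continuous_subtype_val hγ
      exact hγ.continuous.subtype_mk _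
    · have : Set.range f = Subtype.val ⁻¹' U := by
        ext y
        constructor
        · rintro ⟨s, rfl⟩
          exact (hU.subset ⟨s, s.2, rfl⟩).2
        · intro hy
          obtain ⟨s, hs, hsy⟩ := hU.superset ⟨y.2, hy⟩
          exact ⟨⟨s, hs⟩, Subtype.ext hsy⟩
      rw [this]
      exact hUo.preimage continuous_subtype_val
  have : Nonempty S := ⟨t⟩
  have hft : f t = x := Subtype.ext hx
  refine ⟨(hf.toOpenPartialHomeomorph f).symm.trans (hg.toOpenPartialHomeomorph g), ?_, ?_⟩
  · simp [← hft]
  · rw [← hft]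
    simp [hf.toOpenPartialHomeomorph_left_inv]

variable {V : Type*} [NormedAddCommGroup V] [NormedSpace ℝ V]

/-- The inclusion of a subset of the line into the half-line, after a translation. -/
lemma isOpenEmbedding_halfSpace {S : Set ℝ} {c : ℝ} (h : ∀ t ∈ S, 0 ≤ t + c) {W : Set ℝ}
    (hW : IsOpen W) (hS : ∀ t, 0 ≤ t + c → (t ∈ S ↔ t ∈ W)) :
    Topology.IsOpenEmbedding fun t : S =>
      (⟨!₂[(t : ℝ) + c], by simpa using h t t.2⟩ : EuclideanHalfSpace 1) := by
  have hcoord : Continuous fun y : EuclideanHalfSpace 1 => y.1 0 - c := by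
    have : Continuous fun y : EuclideanHalfSpace 1 => y.1 := continuous_subtype_val
    fun_prop
  refine ⟨?_, ?_⟩
  -- Subtracting `c` from the coordinate is a continuous left inverse.
  · refine Topology.IsEmbedding.of_comp (g := fun y : EuclideanHalfSpace 1 => y.1 0 - c)
      ?_ hcoord ?_
    · refine Continuous.subtype_mk ?_ _
      refine (PiLp.continuous_toLp 2 _).comp ?_
      refine continuous_pi fun i => ?_
      fin_cases i
      exact continuous_subtype_val.add continuous_const
    · have : ((fun y : EuclideanHalfSpace 1 => y.1 0 - c) ∘ fun t : S =>
        (⟨!₂[(t : ℝ) + c], by simpa using h t t.2⟩ : EuclideanHalfSpace 1)) = Subtype.val := by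
        ext t
        simp
      rw [this]
      exact Topology.IsEmbedding.subtypeVal
  · have : Set.range (fun t : S =>
        (⟨!₂[(t : ℝ) + c], by simpa using h t t.2⟩ : EuclideanHalfSpace 1)) =
        (fun y : EuclideanHalfSpace 1 => y.1 0 - c) ⁻¹' W := by
      ext y
      have hy : 0 ≤ y.1 0 := y.2
      constructor
      · rintro ⟨t, rfl⟩
        simpa using (hS t (h t t.2)).1 t.2
      · intro hyW
        refine ⟨⟨y.1 0 - c, (hS _ (by simpa using hy)).2 hyW⟩, ?_⟩
        apply Subtype.ext
        ext i
        fin_cases i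
        simp
    rw [this]
    exact hW.preimage hcoord

/-- A piecewise smooth curve with boundary `B` is a one-manifold with boundary `B`. -/
theorem IsPiecewiseSmoothCurve.exists_chartedSpace {cells : Set (Set V)} {M B : Set V}
    (h : IsPiecewiseSmoothCurve cells M B) :
    ∃ _ : ChartedSpace (EuclideanHalfSpace 1) M,
      (𝓡∂ 1).boundary M = Subtype.val ⁻¹' B := by
  -- A boundary arc goes into the half-line unshifted, so its end has coordinate 0; an open arc is
  -- shifted by 1, so its centre has coordinate 1.
  have key : ∀ x : M, ∃ e : OpenPartialHomeomorph M (EuclideanHalfSpace 1),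
      x ∈ e.source ∧ ((e x).1 0 = 0 ↔ (x : V) ∈ B) := by
    intro x
    by_cases hx : (x : V) ∈ B
    · obtain ⟨γ, h0, hγ, hU, -⟩ := h.at_boundary x hx
      obtain ⟨e, he, hex⟩ := exists_chart_of_arc
        (isOpenEmbedding_halfSpace (S := Set.Ico (0 : ℝ) 1) (c := 0) (by simp +contextual)
          (isOpen_Iio (a := (1 : ℝ))) (by simp +contextual)) hγ hU x ⟨0, by simp⟩ h0
      exact ⟨e, he, by simp [hex, hx]⟩
    · obtain ⟨γ, h0, hγ, hU, -⟩ := h.at_interior x ⟨x.2, hx⟩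
      obtain ⟨e, he, hex⟩ := exists_chart_of_arc
        (isOpenEmbedding_halfSpace (S := Set.Ioo (-1 : ℝ) 1) (c := 1)
          (fun t ht => by linarith [ht.1])
          (isOpen_Ioo (a := (-1 : ℝ)) (b := 1)) (by simp)) hγ hU x ⟨0, by simp⟩ h0
      exact ⟨e, he, by simp [hex, hx]⟩
  choose e he hx using key
  -- Whether a point is on the boundary is read off in its own preferred chart, so no two charts
  -- have to be compared.
  let _ : ChartedSpace (EuclideanHalfSpace 1) M :=
    { atlas := Set.range e, chartAt := e, mem_chart_source := he,
      chart_mem_atlas := fun x => ⟨x, rfl⟩ }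
  refine ⟨inferInstance, ?_⟩
  ext x
  change extChartAt (𝓡∂ 1) x x ∈ frontier (Set.range (𝓡∂ 1)) ↔ _
  rw [frontier_range_modelWithCornersEuclideanHalfSpace, Set.mem_preimage, ← hx x]
  change 0 = (e x x).1 0 ↔ _
  exact eq_comm

/-- Applying `ψ` to the derivative gives the nonzero slope `c`, so the derivative cannot vanish and
need not be computed. -/
lemma isSmoothPiece_of_linear_parameter {cells : Set (Set V)} {γ : ℝ → V} {s : Set ℝ}
    (hs : UniqueDiffOn ℝ s) (hγ : ContDiffOn ℝ ∞ γ s) (ψ : V →L[ℝ] ℝ) {c d : ℝ} (hc : c ≠ 0)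
    (hψ : ∀ t ∈ s, ψ (γ t) = d + c * t) (hcell : ∃ Q ∈ cells, Set.MapsTo γ s Q) :
    IsSmoothPiece cells γ s := by
  refine ⟨hγ, fun t ht h0 => hc ?_, hcell⟩
  have h1 : HasDerivWithinAt γ (derivWithin γ s t) s t :=
    ((hγ t ht).differentiableWithinAt (by simp)).hasDerivWithinAt
  have h2 : HasDerivWithinAt (fun t => ψ (γ t)) (ψ (derivWithin γ s t)) s t :=
    ψ.hasFDerivAt.comp_hasDerivWithinAt t h1
  have h3 : HasDerivWithinAt (fun t => ψ (γ t)) c s t := by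
    have : HasDerivWithinAt (fun t => d + c * t) c s t := by
      simpa using (((hasDerivAt_id t).const_mul c).const_add d).hasDerivWithinAt
    exact this.congr hψ (hψ t ht)
  rw [← (hs t ht).eq_deriv _ h2 h3, h0, map_zero]

/-- The functional, renormalized, is a continuous left inverse of `γ`. -/
lemma isEmbedding_of_linear_parameter {γ : ℝ → V} {s : Set ℝ} (hγ : ContinuousOn γ s)
    (ψ : V →L[ℝ] ℝ) {c d : ℝ} (hc : c ≠ 0) (hψ : ∀ t ∈ s, ψ (γ t) = d + c * t) :
    Topology.IsEmbedding (s.domRestrict γ) := by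
  refine Topology.IsEmbedding.of_comp (g := fun y => (ψ y - d) / c)
    (continuousOn_iff_continuous_domRestrict.1 hγ) (by fun_prop) ?_
  have : (fun y => (ψ y - d) / c) ∘ s.domRestrict γ = Subtype.val := by
    ext t
    simp [hψ t t.2, hc]
  rw [this]
  exact Topology.IsEmbedding.subtypeVal

lemma contDiffOn_comp_mul_left {γ : ℝ → V} {s s' : Set ℝ} {r : ℝ} (h : ContDiffOn ℝ ∞ γ s)
    (hs : ∀ t ∈ s', r * t ∈ s) : ContDiffOn ℝ ∞ (fun t => γ (r * t)) s' :=
  h.comp (t := s) (by fun_prop) hs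

/-- An open arc that is parametrized by a linear functional, rescaled to the interval `(-1, 1)`. -/
lemma exists_openArc {cells : Set (Set V)} {M : Set V} {γ : ℝ → V} {r : ℝ} (hr : 0 < r)
    (ψ : V →L[ℝ] ℝ) (hψ : ∀ t ∈ Set.Ioo (-r) r, ψ (γ t) = ψ (γ 0) + t)
    (hcont : ContinuousOn γ (Set.Ioo (-r) r))
    (hU : ∃ U, IsOpen U ∧ γ '' Set.Ioo (-r) r = M ∩ U)
    (hl : ContDiffOn ℝ ∞ γ (Set.Ioc (-r) 0)) (hr' : ContDiffOn ℝ ∞ γ (Set.Ico 0 r))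
    (hcl : ∃ Q ∈ cells, Set.MapsTo γ (Set.Ioc (-r) 0) Q)
    (hcr : ∃ Q ∈ cells, Set.MapsTo γ (Set.Ico 0 r) Q) :
    ∃ γ' : ℝ → V, γ' 0 = γ 0 ∧
      Topology.IsEmbedding ((Set.Ioo (-1 : ℝ) 1).domRestrict γ') ∧
      (∃ U, IsOpen U ∧ γ' '' Set.Ioo (-1 : ℝ) 1 = M ∩ U) ∧
      IsSmoothPiece cells γ' (Set.Ioc (-1 : ℝ) 0) ∧
      IsSmoothPiece cells γ' (Set.Ico (0 : ℝ) 1) := by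
  have hm : ∀ t ∈ Set.Ioo (-1 : ℝ) 1, r * t ∈ Set.Ioo (-r) r := fun t ht =>
    ⟨by nlinarith [ht.1], by nlinarith [ht.2]⟩
  have hml : ∀ t ∈ Set.Ioc (-1 : ℝ) 0, r * t ∈ Set.Ioc (-r) 0 := fun t ht =>
    ⟨by nlinarith [ht.1], by nlinarith [ht.2]⟩
  have hmr : ∀ t ∈ Set.Ico (0 : ℝ) 1, r * t ∈ Set.Ico 0 r := fun t ht =>
    ⟨by nlinarith [ht.1], by nlinarith [ht.2]⟩
  refine ⟨fun t => γ (r * t), by simp, ?_, ?_, ?_, ?_⟩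
  · exact isEmbedding_of_linear_parameter (hcont.comp (by fun_prop) hm) ψ hr.ne'
      (fun t ht => hψ _ (hm t ht))
  · obtain ⟨U, hUo, hU⟩ := hU
    refine ⟨U, hUo, hU ▸ ?_⟩
    ext y
    constructor
    · rintro ⟨t, ht, rfl⟩
      exact ⟨r * t, hm t ht, rfl⟩
    · rintro ⟨t, ht, rfl⟩
      refine ⟨t / r, ⟨?_, ?_⟩, ?_⟩
      · rw [lt_div_iff₀ hr]; linarith [ht.1]
      · rw [div_lt_iff₀ hr]; linarith [ht.2]
      · change γ (r * (t / r)) = γ t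
        rw [mul_div_cancel₀ _ hr.ne']
  · refine isSmoothPiece_of_linear_parameter (uniqueDiffOn_Ioc _ _) (contDiffOn_comp_mul_left hl hml)
      ψ hr.ne'
      (fun t ht => hψ _ (hm t ⟨ht.1, ht.2.trans_lt one_pos⟩)) ?_
    obtain ⟨Q, hQ, h⟩ := hcl
    exact ⟨Q, hQ, fun t ht => h (hml t ht)⟩
  · refine isSmoothPiece_of_linear_parameter (uniqueDiffOn_Ico _ _) (contDiffOn_comp_mul_left hr' hmr)
      ψ hr.ne'
      (fun t ht => hψ _ (hm t ⟨by linarith [ht.1], ht.2⟩)) ?_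
    obtain ⟨Q, hQ, h⟩ := hcr
    exact ⟨Q, hQ, fun t ht => h (hmr t ht)⟩

/-- A half-open arc that is parametrized by a linear functional, rescaled to `[0, 1)`. -/
lemma exists_halfOpenArc {cells : Set (Set V)} {M : Set V} {γ : ℝ → V} {r : ℝ} (hr : 0 < r)
    (ψ : V →L[ℝ] ℝ) (hψ : ∀ t ∈ Set.Ico 0 r, ψ (γ t) = ψ (γ 0) + t)
    (hU : ∃ U, IsOpen U ∧ γ '' Set.Ico 0 r = M ∩ U)
    (hγ : ContDiffOn ℝ ∞ γ (Set.Ico 0 r))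
    (hc : ∃ Q ∈ cells, Set.MapsTo γ (Set.Ico 0 r) Q) :
    ∃ γ' : ℝ → V, γ' 0 = γ 0 ∧
      Topology.IsEmbedding ((Set.Ico (0 : ℝ) 1).domRestrict γ') ∧
      (∃ U, IsOpen U ∧ γ' '' Set.Ico (0 : ℝ) 1 = M ∩ U) ∧
      IsSmoothPiece cells γ' (Set.Ico (0 : ℝ) 1) := by
  have hm : ∀ t ∈ Set.Ico (0 : ℝ) 1, r * t ∈ Set.Ico 0 r := fun t ht =>
    ⟨by nlinarith [ht.1], by nlinarith [ht.2]⟩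
  have hγ' := contDiffOn_comp_mul_left hγ hm
  refine ⟨fun t => γ (r * t), by simp, ?_, ?_, ?_⟩
  · exact isEmbedding_of_linear_parameter hγ'.continuousOn ψ hr.ne'
      (fun t ht => hψ _ (hm t ht))
  · obtain ⟨U, hUo, hU⟩ := hU
    refine ⟨U, hUo, hU ▸ ?_⟩
    ext y
    constructor
    · rintro ⟨t, ht, rfl⟩
      exact ⟨r * t, hm t ht, rfl⟩
    · rintro ⟨t, ht, rfl⟩
      refine ⟨t / r, ⟨div_nonneg ht.1 hr.le, ?_⟩, ?_⟩
      · rw [div_lt_iff₀ hr]; linarith [ht.2]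
      · change γ (r * (t / r)) = γ t
        rw [mul_div_cancel₀ _ hr.ne']
  · refine isSmoothPiece_of_linear_parameter (uniqueDiffOn_Ico _ _) hγ' ψ hr.ne'
      (fun t ht => hψ _ (hm t ht)) ?_
    obtain ⟨Q, hQ, h⟩ := hc
    exact ⟨Q, hQ, fun t ht => h (hm t ht)⟩

end Arcs

/-! ### The triple product -/

/-- The triple product of three vectors of space. -/
def det3 (a b c : E3) : ℝ :=
  a 0 * (b 1 * c 2 - b 2 * c 1) - a 1 * (b 0 * c 2 - b 2 * c 0) + a 2 * (b 0 * c 1 - b 1 * c 0)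

lemma det3_eq_det (a b c : E3) :
    det3 a b c = Matrix.det (Matrix.of ![(a : Fin 3 → ℝ), b, c]) := by
  simp [det3, Matrix.det_fin_three]
  ring

/-- Cramer's rule. -/
lemma det3_cramer (a b c z : E3) :
    det3 a b c • z = det3 z b c • a + det3 a z c • b + det3 a b z • c := by
  ext i
  fin_cases i <;> simp [det3] <;> ring

@[fun_prop]
lemma contDiff_det3 {V : Type*} [NormedAddCommGroup V] [NormedSpace ℝ V] {f g h : V → E3}
    (hf : ContDiff ℝ ∞ f) (hg : ContDiff ℝ ∞ g) (hh : ContDiff ℝ ∞ h) :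
    ContDiff ℝ ∞ fun y => det3 (f y) (g y) (h y) := by
  have hp : ∀ {f : V → E3}, ContDiff ℝ ∞ f → ∀ i, ContDiff ℝ ∞ fun y => f y i :=
    fun hf i => (contDiff_euclidean.1 hf) i
  have := hp hf; have := hp hg; have := hp hh
  unfold det3
  fun_prop (disch := assumption)

lemma det3_ne_zero_of_linearIndependent {a b c : E3} (h : LinearIndependent ℝ ![a, b, c]) :
    det3 a b c ≠ 0 := by
  intro h0
  rw [det3_eq_det] at h0
  obtain ⟨w, hw, hw0⟩ := Matrix.exists_vecMul_eq_zero_iff.2 h0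
  apply hw
  rw [Fintype.linearIndependent_iff] at h
  funext i
  refine h w ?_ i
  ext j
  have := congrFun hw0 j
  simpa [Matrix.vecMul, dotProduct, Fin.sum_univ_three] using this

/-- Six times the signed volume of a tetrahedron. -/
def vol (a b c d : E3) : ℝ := det3 (b - a) (c - a) (d - a)

/-! ### Nondegenerate polygons: volumes, indices, edges and straight subarcs -/

section Polygon

variable {n : ℕ} {v : Fin n → E3}

/-- Four non-coplanar points are affinely independent, so their difference vectors have nonzero
determinant. Almost every use of general position below goes through this. -/
lemma vol_ne_zero (hv : IsNondegenerate v) {i j k l : Fin n} (hij : i ≠ j) (hik : i ≠ k)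
    (hil : i ≠ l) (hjk : j ≠ k) (hjl : j ≠ l) (hkl : k ≠ l) : vol (v i) (v j) (v k) (v l) ≠ 0 := by
  have hf : Function.Injective ![i, j, k, l] := by
    intro a b
    fin_cases a <;> fin_cases b <;> simp [*, Ne.symm]
  have h := hv.not_coplanar _ hf
  have h2 : AffineIndependent ℝ fun m => v (![i, j, k, l] m) := by
    by_contra h3
    apply h
    rw [coplanar_iff_finrank_le_two]
    rwa [← finrank_vectorSpan_le_iff_not_affineIndependent ℝ _ (n := 2) (by simp)] at h3
  rw [affineIndependent_iff_linearIndependent_vsub ℝ _ 0] at h2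
  apply det3_ne_zero_of_linearIndependent
  let e : Fin 3 ≃ {x : Fin 4 // x ≠ 0} := finSuccAboveEquiv 0
  have h4 := h2.comp e e.injective
  have h5 : ![v j - v i, v k - v i, v l - v i] =
      (fun m : {x : Fin 4 // x ≠ 0} => v (![i, j, k, l] m) -ᵥ v (![i, j, k, l] 0)) ∘ e := by
    funext m
    fin_cases m <;> rfl
  rw [h5]
  exact h4

lemma eq_zero_of_smul_add_smul (hv : IsNondegenerate v) {i j k : Fin n} (hij : i ≠ j) (hik : i ≠ k)
    (hjk : j ≠ k) {s t : ℝ} (h : s • (v j - v i) + t • (v k - v i) = 0) : s = 0 ∧ t = 0 := by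
  have hf : Function.Injective ![i, j, k] := by
    intro a b
    fin_cases a <;> fin_cases b <;> simp [*, Ne.symm]
  have h2 := affineIndependent_iff_not_collinear.2 (hv.not_collinear _ hf)
  rw [affineIndependent_iff_linearIndependent_vsub ℝ _ 0] at h2
  let e : Fin 2 ≃ {x : Fin 3 // x ≠ 0} := finSuccAboveEquiv 0
  have h4 := h2.comp e e.injective
  have h5 : LinearIndependent ℝ ![v j - v i, v k - v i] := by
    have h6 : ![v j - v i, v k - v i] =
        (fun m : {x : Fin 3 // x ≠ 0} => v (![i, j, k] m) -ᵥ v (![i, j, k] 0)) ∘ e := by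
      funext m
      fin_cases m <;> rfl
    rw [h6]
    exact h4
  exact LinearIndependent.pair_iff.1 h5 s t h

/-! ### Cyclic indices -/

variable [NeZero n]

lemma fin_one_ne_zero (hn : 3 ≤ n) : (1 : Fin n) ≠ 0 := by
  intro h
  have := congrArg Fin.val h
  rw [Fin.val_one', Nat.mod_eq_of_lt (by omega)] at this
  simp at this

lemma fin_two_ne_zero (hn : 3 ≤ n) : (1 + 1 : Fin n) ≠ 0 := by
  intro h
  have := congrArg Fin.val h
  rw [Fin.val_add, Fin.val_one', Nat.mod_eq_of_lt (by omega : 1 < n),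
    Nat.mod_eq_of_lt (by omega)] at this
  simp at this

/-- Four consecutive vertices are distinct only from `n = 4` on; this is why triangles are treated
apart. -/
lemma fin_three_ne_zero (hn : 4 ≤ n) : (1 + 1 + 1 : Fin n) ≠ 0 := by
  intro h
  have := congrArg Fin.val h
  rw [Fin.val_add, Fin.val_add, Fin.val_one', Nat.mod_eq_of_lt (by omega : 1 < n),
    Nat.mod_eq_of_lt (by omega : 1 + 1 < n), Nat.mod_eq_of_lt (by omega)] at this
  simp at this

lemma ne_add_one (hn : 3 ≤ n) (i : Fin n) : i ≠ i + 1 := by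
  simpa using fin_one_ne_zero hn

lemma ne_add_two (hn : 3 ≤ n) (i : Fin n) : i ≠ i + 1 + 1 := by
  simpa [add_assoc] using fin_two_ne_zero hn

lemma ne_add_three (hn : 4 ≤ n) (i : Fin n) : i ≠ i + 1 + 1 + 1 := by
  simpa [add_assoc] using fin_three_ne_zero hn

/-- Two indices whose edges are neither equal nor adjacent. -/
def Apart (i j : Fin n) : Prop := i ≠ j ∧ j ≠ i + 1 ∧ i ≠ j + 1

lemma Apart.symm {i j : Fin n} (h : Apart i j) : Apart j i := ⟨h.1.symm, h.2.2, h.2.1⟩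

/-! ### Points on edges -/

/-- The affine parametrization of the line of an edge. -/
def pt (v : Fin n → E3) (i : Fin n) (t : ℝ) : E3 := v i + t • (v (i + 1) - v i)

@[simp] lemma pt_zero (v : Fin n → E3) (i : Fin n) : pt v i 0 = v i := by simp [pt]

@[simp] lemma pt_one (v : Fin n → E3) (i : Fin n) : pt v i 1 = v (i + 1) := by simp [pt]

lemma mem_edge {i : Fin n} {y : E3} : y ∈ edge v i ↔ ∃ t, 0 ≤ t ∧ t ≤ 1 ∧ y = pt v i t := by
  rw [edge, segment_eq_image']
  constructor
  · rintro ⟨t, ht, rfl⟩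
    exact ⟨t, ht.1, ht.2, rfl⟩
  · rintro ⟨t, h0, h1, rfl⟩
    exact ⟨t, ⟨h0, h1⟩, rfl⟩

lemma left_mem_edge (i : Fin n) : v i ∈ edge v i := left_mem_segment ℝ _ _

lemma right_mem_edge (i : Fin n) : v (i + 1) ∈ edge v i := right_mem_segment ℝ _ _

lemma mem_curve {y : E3} : y ∈ curve v ↔ ∃ i, y ∈ edge v i := Set.mem_iUnion

lemma isCompact_edge (i : Fin n) : IsCompact (edge v i) := by
  rw [edge, segment_eq_image']
  exact isCompact_Icc.image (by fun_prop)

lemma isClosed_edge (i : Fin n) : IsClosed (edge v i) := (isCompact_edge i).isClosed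

lemma isCompact_curve : IsCompact (curve v) := isCompact_iUnion isCompact_edge

/-- Up to sign this is the volume of the tetrahedron on the four distinct endpoints; it says that
the lines of the two edges are skew. -/
lemma det3_ne_zero_of_apart (hn : 3 ≤ n) (hv : IsNondegenerate v) {i j : Fin n} (h : Apart i j) :
    det3 (v (i + 1) - v i) (v (j + 1) - v j) (v j - v i) ≠ 0 := by
  have := vol_ne_zero hv (ne_add_one hn i) h.1 h.2.2 h.2.1.symm
    (fun h' => h.1 (add_right_cancel h')) (ne_add_one hn j)
  contrapose! this
  rw [← neg_eq_zero, ← this, vol]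
  simp only [det3, PiLp.sub_apply]
  ring

lemma pt_injective (hn : 3 ≤ n) (hv : IsNondegenerate v) {i : Fin n} {s t : ℝ}
    (h : pt v i s = pt v i t) : s = t := by
  -- The next vertex enters with coefficient 0, only to make independence of two vectors applicable.
  have h1 : (s - t) • (v (i + 1) - v i) + (0 : ℝ) • (v (i + 1 + 1) - v i) = 0 := by
    rw [pt, pt, add_left_cancel_iff] at h
    rw [sub_smul, h]
    simp
  have := (eq_zero_of_smul_add_smul hv (ne_add_one hn i) (ne_add_two hn i)
    (ne_add_one hn (i + 1)) h1).1
  linarith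

/-- The lines of two different edges meet at most in a common vertex. -/
lemma pt_eq_pt (hn : 3 ≤ n) (hv : IsNondegenerate v) {i j : Fin n} (hij : i ≠ j) {s t : ℝ}
    (h : pt v i s = pt v j t) : (j = i + 1 ∧ s = 1 ∧ t = 0) ∨ (i = j + 1 ∧ s = 0 ∧ t = 1) := by
  have key : ∀ (i : Fin n) {s t : ℝ}, pt v i s = pt v (i + 1) t → s = 1 ∧ t = 0 := by
    intro i s t h
    have h1 : (1 - s) • (v i - v (i + 1)) + (-t) • (v (i + 1 + 1) - v (i + 1)) = 0 := by
      rw [pt, pt, ← sub_eq_zero] at h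
      rw [← h]
      module
    have := eq_zero_of_smul_add_smul hv (ne_add_one hn i).symm (ne_add_one hn (i + 1))
      (ne_add_two hn i) h1
    exact ⟨by linarith, by linarith⟩
  by_cases h1 : j = i + 1
  · subst h1
    exact Or.inl ⟨rfl, key i h⟩
  by_cases h2 : i = j + 1
  · subst h2
    exact Or.inr ⟨rfl, (key j h.symm).2, (key j h.symm).1⟩
  -- For non-adjacent edges an intersection would make the connecting vector a combination of the
  -- two directions, against skewness.
  exfalso
  apply det3_ne_zero_of_apart hn hv ⟨hij, h1, h2⟩
  have h3 : v j - v i = s • (v (i + 1) - v i) - t • (v (j + 1) - v j) := by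
    rw [pt, pt] at h
    rw [sub_eq_sub_iff_add_eq_add, ← h, add_comm]
  rw [h3]
  simp only [det3, PiLp.sub_apply, PiLp.smul_apply, smul_eq_mul]
  ring

lemma eq_of_mem_edge_of_ne (hn : 3 ≤ n) (hv : IsNondegenerate v) {i j : Fin n} {y : E3}
    (hi : y ∈ edge v i) (hj : y ∈ edge v j) (hy : ∀ k, y ≠ v k) : i = j := by
  obtain ⟨s, -, -, rfl⟩ := mem_edge.1 hi
  obtain ⟨t, -, -, h⟩ := mem_edge.1 hj
  by_contra hij
  rcases pt_eq_pt hn hv hij h with ⟨-, rfl, -⟩ | ⟨-, rfl, -⟩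
  · exact hy (i + 1) (by simp)
  · exact hy i (by simp)

lemma vertex_injective (hn : 3 ≤ n) (hv : IsNondegenerate v) {i j : Fin n} (h : v i = v j) :
    i = j := by
  by_contra hij
  rcases pt_eq_pt hn hv hij (s := 0) (t := 0) (by simpa using h) with ⟨-, h, -⟩ | ⟨-, -, h⟩ <;>
    norm_num at h

/-- A vertex lies only on the two edges incident to it. -/
lemma vertex_mem_edge (hn : 3 ≤ n) (hv : IsNondegenerate v) {i j : Fin n} (h : v i ∈ edge v j) :
    i = j ∨ i = j + 1 := by
  obtain ⟨t, -, -, h⟩ := mem_edge.1 h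
  by_contra! hij
  rcases pt_eq_pt hn hv hij.1 (s := 0) (by simpa using h) with ⟨-, h, -⟩ | ⟨h, -⟩
  · norm_num at h
  · exact hij.2 h

/-! ### Straight subarcs -/

/-- Finitely many edges cover the segment near `a`, so one of them is met for arbitrarily small `t`;
being closed, it also contains `a`. -/
lemma exists_edge_germ {a b : E3} (h : segment ℝ a b ⊆ curve v) :
    ∃ i, a ∈ edge v i ∧ ∃ t : ℝ, 0 < t ∧ AffineMap.lineMap a b t ∈ edge v i := by
  have hK : ∀ᶠ t : ℝ in nhdsWithin 0 (Set.Ioi 0), AffineMap.lineMap a b t ∈ curve v := by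
    filter_upwards [Ioo_mem_nhdsGT (one_pos (α := ℝ))] with t ht
    exact h (by rw [segment_eq_image_lineMap]; exact ⟨t, ⟨ht.1.le, ht.2.le⟩, rfl⟩)
  obtain ⟨i, hi⟩ : ∃ i, ∃ᶠ t : ℝ in nhdsWithin 0 (Set.Ioi 0),
      AffineMap.lineMap a b t ∈ edge v i := by
    by_contra hcon
    simp only [not_exists, Filter.not_frequently] at hcon
    obtain ⟨t, h1, h2⟩ := (hK.and (Filter.eventually_all.2 hcon)).exists
    obtain ⟨i, hi⟩ := mem_curve.1 h1
    exact h2 i hi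
  refine ⟨i, ?_, ?_⟩
  · have hc : Continuous fun t : ℝ => (AffineMap.lineMap a b t : E3) :=
      AffineMap.lineMap_continuous
    have h0 := (isClosed_edge (v := v) i).preimage hc
    have : (0 : ℝ) ∈ (fun t : ℝ => (AffineMap.lineMap a b t : E3)) ⁻¹' edge v i := by
      rw [← h0.closure_eq, mem_closure_iff_frequently]
      exact hi.filter_mono nhdsWithin_le_nhds
    simpa using this
  · obtain ⟨t, h1, h2⟩ := (hi.and_eventually self_mem_nhdsWithin).exists
    exact ⟨t, h2, h1⟩

/-- The germs of the segment at its two ends lie on edges `i` and `j`, whose lines both contain two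
distinct points of the line of the segment. Lines of different edges share at most one point, so `i
= j`. -/
lemma inStraightSubarc_iff (hn : 3 ≤ n) (hv : IsNondegenerate v) {a b : E3} :
    InStraightSubarc (curve v) a b ↔ ∃ i, a ∈ edge v i ∧ b ∈ edge v i := by
  constructor
  · intro h
    obtain ⟨i, hi, s, hs, his⟩ := exists_edge_germ h
    rw [InStraightSubarc, segment_symm] at h
    obtain ⟨j, hj, t, ht, hjt⟩ := exists_edge_germ h
    by_cases hab : a = b
    · exact ⟨i, hi, hab ▸ hi⟩
    obtain ⟨α, -, -, hα⟩ := mem_edge.1 hi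
    obtain ⟨β, -, -, hβ⟩ := mem_edge.1 his
    obtain ⟨α', -, -, hα'⟩ := mem_edge.1 hj
    obtain ⟨β', -, -, hβ'⟩ := mem_edge.1 hjt
    have hline : ∀ r : ℝ, AffineMap.lineMap a b r = pt v i (α + r / s * (β - α)) := by
      intro r
      have h1 : b - a = ((β - α) / s) • (v (i + 1) - v i) := by
        rw [AffineMap.lineMap_apply_module', hα, pt, pt] at hβ
        rw [hα, pt, div_eq_inv_mul, mul_smul, eq_inv_smul_iff₀ hs.ne']
        have := congrArg (fun z => z - (v i + α • (v (i + 1) - v i))) hβ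
        simp only [add_sub_cancel_right] at this
        rw [this]
        module
      rw [AffineMap.lineMap_apply_module', h1, hα, pt, pt]
      match_scalars <;> field_simp <;> ring
    have hij : i = j := by
      by_contra hij
      have e1 : pt v i (α + 1 / s * (β - α)) = pt v j α' := by
        rw [← hline, ← hα']
        simp
      have e2 : pt v i (α + (1 - t) / s * (β - α)) = pt v j β' := by
        rw [← hline, ← hβ', AffineMap.lineMap_apply_one_sub]
      have hαβ : α ≠ β := by
        rintro rfl
        have := hline 1
        rw [sub_self, mul_zero, add_zero, ← hα, AffineMap.lineMap_apply_one] at this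
        exact hab this.symm
      have h12 : α + 1 / s * (β - α) ≠ α + (1 - t) / s * (β - α) := by
        intro h
        have : t / s * (β - α) = 0 := by linear_combination h
        have h' : t / s ≠ 0 := (div_pos ht hs).ne'
        exact hαβ (by linarith [(mul_eq_zero.1 this).resolve_left h'])
      rcases pt_eq_pt hn hv hij e1 with ⟨h1, h2, -⟩ | ⟨h1, h2, -⟩ <;>
      rcases pt_eq_pt hn hv hij e2 with ⟨h3, h4, -⟩ | ⟨h3, h4, -⟩
      · exact h12 (h2.trans h4.symm)
      · exact ne_add_two hn j (by rw [← h3]; exact h1)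
      · exact ne_add_two hn i (by rw [← h3]; exact h1)
      · exact h12 (h2.trans h4.symm)
    exact ⟨i, hi, hij ▸ hj⟩
  · rintro ⟨i, ha, hb⟩
    exact ((convex_segment _ _).segment_subset ha hb).trans (Set.subset_iUnion (edge v) i)

end Polygon

/-! ### Trisecants as ordered collinear triples, and the position of their edges -/

section Trisecants

variable {n : ℕ} [NeZero n] {v : Fin n → E3}

/-- Points of a subset of a line that lie in the same component are joined by a segment of it. -/
lemma inStraightSubarc_of_connectedComponents_eq {K : Set E3} {p q : E3}
    (hpq : p ≠ q) {a b : ↥((line[ℝ, p, q] : Set E3) ∩ K)}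
    (h : (a : ConnectedComponents ↥((line[ℝ, p, q] : Set E3) ∩ K)) = b) :
    InStraightSubarc K a b := by
  have hne : ‖q - p‖ ^ 2 ≠ 0 := by simpa [sub_eq_zero] using Ne.symm hpq
  -- The affine coordinate on the line, extended to space by orthogonal projection. The image of a
  -- component is an interval, so it contains all parameters between those of `a` and `b`.
  let τ : E3 → ℝ := fun y => inner ℝ (q - p) (y - p) / ‖q - p‖ ^ 2
  have hτ : Continuous τ := by fun_prop
  have hτline : ∀ s : ℝ, τ (AffineMap.lineMap p q s) = s := by
    intro s
    simp only [τ, AffineMap.lineMap_apply_module', add_sub_cancel_right, inner_smul_right,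
      real_inner_self_eq_norm_sq]
    exact mul_div_cancel_right₀ _ hne
  have hline : ∀ y ∈ line[ℝ, p, q], AffineMap.lineMap p q (τ y) = y := by
    intro y hy
    obtain ⟨s, rfl⟩ := _root_.mem_affineSpan_pair_iff_exists_lineMap_eq.1 hy
    rw [hτline]
  have hC := isPreconnected_connectedComponent (x := a)
  have hb : b ∈ connectedComponent a := by
    rw [ConnectedComponents.coe_eq_coe] at h
    exact h ▸ mem_connectedComponent
  have hI := (hC.image (fun y => τ y) (hτ.comp continuous_subtype_val).continuousOn).ordConnected
  intro y hy
  rw [segment_eq_image_lineMap] at hy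
  obtain ⟨θ, hθ, rfl⟩ := hy
  set α := τ a with hα
  set β := τ b with hβ
  have hy : AffineMap.lineMap (a : E3) b θ =
      AffineMap.lineMap p q (AffineMap.lineMap α β θ) := by
    rw [AffineMap.apply_lineMap, hline a a.2.1, hline b b.2.1]
  have hmem : AffineMap.lineMap α β θ ∈ Set.uIcc α β := by
    rw [← segment_eq_uIcc, segment_eq_image_lineMap]
    exact ⟨θ, hθ, rfl⟩
  obtain ⟨c, -, hc⟩ := hI.uIcc_subset ⟨a, mem_connectedComponent, rfl⟩ ⟨b, hb, rfl⟩ hmem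
  rw [hy, ← hc, hline c c.2.1]
  exact c.2.2

/-- The count of components comes for free: points in the same component would share a straight
subarc, so the three points already lie in three components. -/
lemma mem_trisecants_iff (hn : 3 ≤ n) (hv : IsNondegenerate v) {x : Fin 3 → E3} :
    x ∈ trisecants (curve v) ↔ (∀ a, x a ∈ curve v) ∧
      (∀ a b, a ≠ b → ∀ i, x a ∈ edge v i → x b ∉ edge v i) ∧ Wbtw ℝ (x 0) (x 1) (x 2) := by
  constructor
  · intro h
    refine ⟨h.mem, fun a b hab i ha hb => h.not_straight a b hab
      ((inStraightSubarc_iff hn hv).2 ⟨i, ha, hb⟩), ?_⟩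
    obtain ⟨p, q, -, -, t, ht, hx⟩ := h.in_order
    rw [hx, hx, hx]
    have h01 := ht (show (0 : Fin 3) < 1 by decide)
    have h12 := ht (show (1 : Fin 3) < 2 by decide)
    have : Wbtw ℝ (t 0) (t 1) (t 2) := Wbtw.of_le_of_le h01.le h12.le
    exact this.map (AffineMap.lineMap p q)
  · rintro ⟨hK, hE, hw⟩
    have hs : ∀ a b, a ≠ b → ¬ InStraightSubarc (curve v) (x a) (x b) := by
      intro a b hab h
      obtain ⟨i, ha, hb⟩ := (inStraightSubarc_iff hn hv).1 h
      exact hE a b hab i ha hb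
    have hne : ∀ a b, a ≠ b → x a ≠ x b := by
      intro a b hab h
      obtain ⟨i, hi⟩ := mem_curve.1 (hK a)
      exact hE a b hab i hi (h ▸ hi)
    obtain ⟨r, ⟨hr0, hr1⟩, hr⟩ := hw
    have hr0' : 0 < r := by
      refine lt_of_le_of_ne hr0 ?_
      rintro rfl
      exact hne 0 1 (by decide) (by simpa using hr)
    have hr1' : r < 1 := by
      refine lt_of_le_of_ne hr1 ?_
      rintro rfl
      exact hne 2 1 (by decide) (by simpa using hr)
    have hx : ∀ i, x i = AffineMap.lineMap (x 0) (x 2) ((![0, r, 1] : Fin 3 → ℝ) i) := by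
      intro i
      fin_cases i
      · simp
      · exact hr.symm
      · simp
    refine ⟨hK, hs, x 0, x 2, hne 0 2 (by decide), ?_, ![0, r, 1], ?_, hx⟩
    · have hmem : ∀ i, x i ∈ (line[ℝ, x 0, x 2] : Set E3) ∩ curve v := by
        intro i
        refine ⟨?_, hK i⟩
        rw [hx i]
        exact AffineMap.lineMap_mem_affineSpan_pair _ _ _
      have hinj : Function.Injective fun i =>
          ((⟨x i, hmem i⟩ : ↥((line[ℝ, x 0, x 2] : Set E3) ∩ curve v)) :
            ConnectedComponents ↥((line[ℝ, x 0, x 2] : Set E3) ∩ curve v)) := by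
        intro a b hab
        by_contra hab'
        exact hs a b hab' (inStraightSubarc_of_connectedComponents_eq (hne 0 2 (by decide)) hab)
      have := ENat.card_le_card_of_injective hinj
      simpa [IsSecantLine] using this
    · intro a b hab
      fin_cases a <;> fin_cases b <;> first | exact absurd hab (by decide) | simp [hr0', hr1']

lemma trisecants_mem_cube {x : Fin 3 → E3} (hx : x ∈ trisecants (curve v)) :
    ∃ f : Fin 3 → Fin n, ∀ a, x a ∈ edge v (f a) := by
  choose f hf using fun a => mem_curve.1 (hx.mem a)
  exact ⟨f, hf⟩

lemma trisecants_not_mem_edge {x : Fin 3 → E3} (hx : x ∈ trisecants (curve v)) {a b : Fin 3}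
    (hab : a ≠ b) {i : Fin n} (ha : x a ∈ edge v i) : x b ∉ edge v i := fun hb =>
  hx.not_straight a b hab
    (((convex_segment _ _).segment_subset ha hb).trans (Set.subset_iUnion (edge v) i))

lemma trisecants_ne {x : Fin 3 → E3} (hx : x ∈ trisecants (curve v)) {a b : Fin 3}
    (hab : a ≠ b) : x a ≠ x b := by
  obtain ⟨i, hi⟩ := mem_curve.1 (hx.mem a)
  exact fun h => trisecants_not_mem_edge hx hab hi (h ▸ hi)

lemma exists_eq_add_smul_of_collinear {x : Fin 3 → E3} (h : Collinear ℝ (Set.range x))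
    {a b : Fin 3} (hab : x a ≠ x b) (c : Fin 3) : ∃ r : ℝ, x c - x a = r • (x b - x a) := by
  obtain ⟨u, hu⟩ := (collinear_iff_of_mem (Set.mem_range_self a)).1 h
  obtain ⟨rb, hb⟩ := hu (x b) (Set.mem_range_self b)
  obtain ⟨rc, hc⟩ := hu (x c) (Set.mem_range_self c)
  rw [vadd_eq_add] at hb hc
  have h0 : rb ≠ 0 := by
    rintro rfl
    exact hab (by simp [hb])
  refine ⟨rc / rb, ?_⟩
  rw [hb, hc, add_sub_cancel_right, add_sub_cancel_right, smul_smul, div_mul_cancel₀ _ h0]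

lemma trisecants_collinear {x : Fin 3 → E3} (hx : x ∈ trisecants (curve v)) :
    Collinear ℝ (Set.range x) := by
  obtain ⟨p, q, -, -, t, -, ht⟩ := hx.in_order
  refine collinear_iff_exists_forall_eq_smul_vadd _ |>.2 ⟨p, q - p, ?_⟩
  rintro _ ⟨i, rfl⟩
  exact ⟨t i, by rw [ht i, AffineMap.lineMap_apply]; rfl⟩

lemma vol_pt (a b c : E3) (k : Fin n) (t : ℝ) :
    vol a b c (pt v k t) = (1 - t) * vol a b c (v k) + t * vol a b c (v (k + 1)) := by
  simp only [vol, det3, pt, PiLp.sub_apply, PiLp.add_apply, PiLp.smul_apply, smul_eq_mul]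
  ring

lemma vol_self_left (a b c : E3) : vol a b c a = 0 := by
  simp only [vol, det3, PiLp.sub_apply]
  ring

lemma vol_self_middle (a b c : E3) : vol a b c b = 0 := by
  simp only [vol, det3, PiLp.sub_apply]
  ring

lemma vol_self_right (a b c : E3) : vol a b c c = 0 := by
  simp only [vol, det3, PiLp.sub_apply]
  ring

/-- If a trisecant meets two adjacent edges, its third point is in their plane. -/
lemma vol_eq_zero_of_adjacent {x : Fin 3 → E3} (hx : x ∈ trisecants (curve v)) {a b : Fin 3}
    (hab : a ≠ b) {i : Fin n} (ha : x a ∈ edge v i) (hb : x b ∈ edge v (i + 1)) (c : Fin 3) :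
    vol (v i) (v (i + 1)) (v (i + 1 + 1)) (x c) = 0 := by
  obtain ⟨r, hr⟩ := exists_eq_add_smul_of_collinear (trisecants_collinear hx)
    (trisecants_ne hx hab) c
  obtain ⟨s, -, -, hs⟩ := mem_edge.1 ha
  obtain ⟨t, -, -, ht⟩ := mem_edge.1 hb
  have h1 : vol (v i) (v (i + 1)) (v (i + 1 + 1)) (x a) = 0 := by
    rw [hs, vol_pt, vol_self_left, vol_self_middle]; ring
  have h2 : vol (v i) (v (i + 1)) (v (i + 1 + 1)) (x b) = 0 := by
    rw [ht, vol_pt, vol_self_right, vol_self_middle]; ring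
  have h3 : vol (v i) (v (i + 1)) (v (i + 1 + 1)) (x c) =
      (1 - r) * vol (v i) (v (i + 1)) (v (i + 1 + 1)) (x a) +
        r * vol (v i) (v (i + 1)) (v (i + 1 + 1)) (x b) := by
    rw [sub_eq_iff_eq_add.1 hr]
    simp only [vol, det3, PiLp.sub_apply, PiLp.add_apply, PiLp.smul_apply, smul_eq_mul]
    ring
  rw [h3, h1, h2]
  ring

/-- The third edge of a trisecant that meets two adjacent edges is not adjacent to them. -/
lemma apart_of_adjacent (hn : 4 ≤ n) (hv : IsNondegenerate v) {x : Fin 3 → E3}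
    (hx : x ∈ trisecants (curve v)) {a b c : Fin 3} (hab : a ≠ b) (hac : a ≠ c) (hbc : b ≠ c)
    {i k : Fin n} (ha : x a ∈ edge v i) (hb : x b ∈ edge v (i + 1)) (hc : x c ∈ edge v k) :
    Apart i k ∧ Apart (i + 1) k := by
  have hn3 : 3 ≤ n := by omega
  have h0 := vol_eq_zero_of_adjacent hx hab ha hb c
  obtain ⟨t, -, -, ht⟩ := mem_edge.1 hc
  rw [ht, vol_pt] at h0
  have hki : i ≠ k := by
    rintro rfl
    exact trisecants_not_mem_edge hx hac ha hc
  have hki1 : k ≠ i + 1 := by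
    rintro rfl
    exact trisecants_not_mem_edge hx hbc hb hc
  -- The edge after `i + 1` starts in the plane of the adjacent edges and ends off it, so its only
  -- point there is the starting vertex, which lies on the edge of `x b`.
  have hki2 : k ≠ i + 1 + 1 := by
    rintro rfl
    rw [vol_self_right, mul_zero, zero_add] at h0
    have := (mul_eq_zero.1 h0).resolve_right (vol_ne_zero hv (ne_add_one hn3 _) (ne_add_two hn3 _)
      (ne_add_three hn _) (ne_add_one hn3 _) (ne_add_two hn3 _) (ne_add_one hn3 _))
    rw [this, pt_zero] at ht
    exact trisecants_not_mem_edge hx hbc hb (ht ▸ right_mem_edge (i + 1))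
  have hki3 : i ≠ k + 1 := by
    rintro rfl
    rw [vol_self_left, mul_zero, add_zero] at h0
    have := (mul_eq_zero.1 h0).resolve_right (vol_ne_zero hv (ne_add_one hn3 _) (ne_add_two hn3 _)
      (ne_add_one hn3 _).symm (ne_add_one hn3 _) (ne_add_two hn3 _).symm (ne_add_three hn _).symm)
    rw [show t = 1 by linarith, pt_one] at ht
    exact trisecants_not_mem_edge hx hac ha (ht ▸ left_mem_edge (k + 1))
  exact ⟨⟨hki, hki1, hki3⟩, hki1.symm, hki2, fun h => hki (add_right_cancel h)⟩

/-- A vertex in the plane of two adjacent edges lies on one of them. -/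
lemma mem_of_vol_eq_zero (hn : 3 ≤ n) (hv : IsNondegenerate v) {i l : Fin n}
    (h : vol (v i) (v (i + 1)) (v (i + 1 + 1)) (v l) = 0) :
    l = i ∨ l = i + 1 ∨ l = i + 1 + 1 := by
  by_contra! hl
  exact vol_ne_zero hv (ne_add_one hn _) (ne_add_two hn _) hl.1.symm (ne_add_one hn _)
    hl.2.1.symm hl.2.2.symm h

/-- A trisecant through a vertex passes through no other vertex, and its other points lie on
edges that are not adjacent. -/
lemma trisecant_through_vertex (hn : 3 ≤ n) (hv : IsNondegenerate v) {x : Fin 3 → E3}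
    (hx : x ∈ trisecants (curve v)) {a b c : Fin 3} (hab : a ≠ b) (hac : a ≠ c) (hbc : b ≠ c)
    {i j k : Fin n} (ha : x a = v i) (hb : x b ∈ edge v j) (hc : x c ∈ edge v k) :
    Apart j k ∧ ∀ l, x b ≠ v l := by
  have hnot : ∀ {b : Fin 3} {j : Fin n}, a ≠ b → x b ∈ edge v j → v i ∉ edge v j :=
    fun hab hb h => trisecants_not_mem_edge hx hab (ha ▸ h) hb
  -- If the other two points were on adjacent edges, `v i` would lie in their plane, hence be a
  -- vertex of one of these edges and share it with a point of the trisecant.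
  have hadj : ∀ {b c : Fin 3} {j : Fin n}, a ≠ b → a ≠ c → b ≠ c → x b ∈ edge v j →
      x c ∉ edge v (j + 1) := by
    intro b c j hab hac hbc hb hc
    have h0 := vol_eq_zero_of_adjacent hx hbc hb hc a
    rw [ha] at h0
    rcases mem_of_vol_eq_zero hn hv h0 with rfl | rfl | rfl
    · exact hnot hab hb (left_mem_edge _)
    · exact hnot hab hb (right_mem_edge _)
    · exact hnot hac hc (right_mem_edge _)
  refine ⟨⟨?_, ?_, ?_⟩, ?_⟩
  · rintro rfl
    exact trisecants_not_mem_edge hx hbc hb hc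
  · rintro rfl
    exact hadj hab hac hbc hb hc
  · rintro rfl
    exact hadj hac hab hbc.symm hc hb
  · intro l hl
    obtain ⟨t, -, -, ht⟩ := mem_edge.1 hc
    obtain ⟨r, hr⟩ := exists_eq_add_smul_of_collinear (trisecants_collinear hx)
      (trisecants_ne hx hab) c
    have hr0 : r ≠ 0 := by
      rintro rfl
      rw [zero_smul, sub_eq_zero] at hr
      exact trisecants_ne hx hac hr.symm
    have hlk : ∀ {m}, v m ∈ edge v k → l ≠ m := by
      rintro m hm rfl
      exact trisecants_not_mem_edge hx hbc (hl ▸ hm) hc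
    have hik : ∀ {m}, v m ∈ edge v k → i ≠ m := by
      rintro m hm rfl
      exact hnot hac hc hm
    have hil : i ≠ l := by
      rintro rfl
      exact trisecants_ne hx hab (ha.trans hl.symm)
    -- With two vertices on the line, these and the endpoints of the edge of `x c` would be four
    -- coplanar vertices.
    refine vol_ne_zero hv hil (hik (left_mem_edge k)) (hik (right_mem_edge k))
      (hlk (left_mem_edge k)) (hlk (right_mem_edge k)) (ne_add_one hn k) ?_
    rw [ha, hl, ht, pt] at hr
    have h1 : r * vol (v i) (v l) (v k) (v (k + 1)) =
        det3 (r • (v l - v i)) (v k - v i) (v (k + 1) - v i) := by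
      simp only [vol, det3, PiLp.sub_apply, PiLp.smul_apply, smul_eq_mul]
      ring
    rw [← hr] at h1
    refine (mul_eq_zero.1 (h1.trans ?_)).resolve_left hr0
    simp only [det3, PiLp.sub_apply, PiLp.add_apply, PiLp.smul_apply, smul_eq_mul]
    ring

/-- Two of the points of a trisecant are interior points of edges that are not adjacent. -/
lemma exists_apart (hn : 4 ≤ n) (hv : IsNondegenerate v) {x : Fin 3 → E3}
    (hx : x ∈ trisecants (curve v)) :
    ∃ s m k : Fin 3, s ≠ m ∧ s ≠ k ∧ m ≠ k ∧ ∃ j l : Fin n, x m ∈ edge v j ∧ x k ∈ edge v l ∧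
      Apart j l ∧ (∀ i, x m ≠ v i) ∧ ∀ i, x k ≠ v i := by
  have hn3 : 3 ≤ n := by omega
  obtain ⟨f, hf⟩ := trisecants_mem_cube hx
  by_cases hvert : ∃ a i, x a = v i
  · obtain ⟨a, i, ha⟩ := hvert
    obtain ⟨m, k, h1, h2, h3⟩ : ∃ m k : Fin 3, a ≠ m ∧ a ≠ k ∧ m ≠ k := by
      clear ha
      revert a; decide
    have hm := trisecant_through_vertex hn3 hv hx h1 h2 h3 ha (hf m) (hf k)
    have hk := trisecant_through_vertex hn3 hv hx h2 h1 h3.symm ha (hf k) (hf m)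
    exact ⟨a, m, k, h1, h2, h3, f m, f k, hf m, hf k, hm.1, hm.2, hk.2⟩
  -- If the edges of `x 0` and `x 1` are adjacent, the third edge is apart from both, so it can be
  -- paired with either.
  · push Not at hvert
    by_cases h01 : Apart (f 0) (f 1)
    · exact ⟨2, 0, 1, by decide, by decide, by decide, _, _, hf 0, hf 1, h01, hvert 0, hvert 1⟩
    by_cases h1 : f 1 = f 0 + 1
    · have := apart_of_adjacent hn hv hx (a := 0) (b := 1) (c := 2) (by decide) (by decide)
        (by decide) (hf 0) (h1 ▸ hf 1) (hf 2)
      exact ⟨1, 0, 2, by decide, by decide, by decide, _, _, hf 0, hf 2, this.1, hvert 0, hvert 2⟩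
    by_cases h2 : f 0 = f 1 + 1
    · have := apart_of_adjacent hn hv hx (a := 1) (b := 0) (c := 2) (by decide) (by decide)
        (by decide) (hf 1) (h2 ▸ hf 0) (hf 2)
      exact ⟨0, 1, 2, by decide, by decide, by decide, _, _, hf 1, hf 2, this.1, hvert 1, hvert 2⟩
    · refine (h01 ⟨fun h => ?_, h1, h2⟩).elim
      exact trisecants_not_mem_edge hx (a := 0) (b := 1) (by decide) (hf 0) (h ▸ hf 1)

end Trisecants

/-! ### Transversals of two skew lines through a given point -/

section Transversal

/-- The set of points through which there is a unique transversal of two skew lines. -/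
def transversalDomain (P D Q E : E3) : Set E3 :=
  {y | det3 E (P - y) D ≠ 0 ∧ det3 E (y - Q) D ≠ 0}

/-- The point on the line through `P` in direction `D` of the transversal through `y`. -/
def transversalLeft (P D Q E y : E3) : E3 :=
  P + (det3 E (P - y) (y - Q) / det3 E (y - Q) D) • D

/-- The point on the line through `Q` in direction `E` of the transversal through `y`. -/
def transversalRight (P D Q E y : E3) : E3 :=
  Q + (det3 (y - Q) (P - y) D / det3 E (P - y) D) • E

lemma isOpen_transversalDomain (P D Q E : E3) : IsOpen (transversalDomain P D Q E) := by
  have h1 : Continuous fun y => det3 E (P - y) D := by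
    apply ContDiff.continuous (𝕜 := ℝ) (n := ∞)
    fun_prop
  have h2 : Continuous fun y => det3 E (y - Q) D := by
    apply ContDiff.continuous (𝕜 := ℝ) (n := ∞)
    fun_prop
  exact (isOpen_ne_fun h1 continuous_const).inter (isOpen_ne_fun h2 continuous_const)

lemma contDiffOn_transversalLeft (P D Q E : E3) :
    ContDiffOn ℝ ∞ (transversalLeft P D Q E) (transversalDomain P D Q E) := by
  have h1 : ContDiff ℝ ∞ fun y => det3 E (P - y) (y - Q) := by fun_prop
  have h2 : ContDiff ℝ ∞ fun y => det3 E (y - Q) D := by fun_prop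
  exact contDiffOn_const.add ((h1.contDiffOn.div h2.contDiffOn fun y hy => hy.2).smul
    contDiffOn_const)

lemma contDiffOn_transversalRight (P D Q E : E3) :
    ContDiffOn ℝ ∞ (transversalRight P D Q E) (transversalDomain P D Q E) := by
  have h1 : ContDiff ℝ ∞ fun y => det3 (y - Q) (P - y) D := by fun_prop
  have h2 : ContDiff ℝ ∞ fun y => det3 E (P - y) D := by fun_prop
  exact contDiffOn_const.add ((h1.contDiffOn.div h2.contDiffOn fun y hy => hy.1).smul
    contDiffOn_const)

/-- The two lines lie in distinct parallel planes with directions `D` and `E`. If `y` were in one of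
them, a line through `y` meeting both lines would lie in that plane, which misses the other line. -/
lemma mem_transversalDomain {P D Q E y : E3} {b c μ : ℝ} (h : det3 D E (Q - P) ≠ 0)
    (hμ : μ ≠ 0) (hy : Q + c • E - y = μ • (P + b • D - y)) : y ∈ transversalDomain P D Q E := by
  have hQ : Q - P = (μ - 1) • (P - y) + (μ * b) • D - c • E := by
    rw [← sub_eq_zero] at hy ⊢
    rw [← hy]
    module
  have h1 : det3 D E (Q - P) = (μ - 1) * det3 E (P - y) D := by
    rw [hQ]
    simp only [det3, PiLp.sub_apply, PiLp.add_apply, PiLp.smul_apply, smul_eq_mul]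
    ring
  have h2 : y - Q = c • E - (μ • (P - y) + (μ * b) • D) := by
    rw [← sub_eq_zero] at hy ⊢
    rw [← neg_zero, ← hy]
    module
  have h3 : det3 E (y - Q) D = -μ * det3 E (P - y) D := by
    rw [h2]
    simp only [det3, PiLp.sub_apply, PiLp.add_apply, PiLp.smul_apply, smul_eq_mul]
    ring
  have h4 : det3 E (P - y) D ≠ 0 := fun h0 => h (by rw [h1, h0, mul_zero])
  exact ⟨h4, h3 ▸ mul_ne_zero (neg_ne_zero.2 hμ) h4⟩

/-- The left point must be where its line meets the plane through `y` and the right line, and vice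
versa; the quotients of triple products are the parameters of these intersections. -/
lemma eq_transversal {P D Q E y : E3} (hy : y ∈ transversalDomain P D Q E) {b c μ : ℝ}
    (h : Q + c • E - y = μ • (P + b • D - y)) :
    P + b • D = transversalLeft P D Q E y ∧ Q + c • E = transversalRight P D Q E y := by
  obtain ⟨hδ, hη⟩ := hy
  have h2 : y - Q = c • E - (μ • (P - y) + (μ * b) • D) := by
    rw [← sub_eq_zero] at h ⊢
    rw [← neg_zero, ← h]
    module
  constructor
  · rw [transversalLeft, add_right_inj]
    congr 1
    rw [eq_div_iff hη, h2]
    simp only [det3, PiLp.sub_apply, PiLp.add_apply, PiLp.smul_apply, smul_eq_mul]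
    ring
  · rw [transversalRight, add_right_inj]
    congr 1
    rw [eq_div_iff hδ, h2]
    simp only [det3, PiLp.sub_apply, PiLp.add_apply, PiLp.smul_apply, smul_eq_mul]
    ring

lemma exists_transversal {P D Q E y : E3} (hy : y ∈ transversalDomain P D Q E) :
    ∃ μ : ℝ, transversalRight P D Q E y - y = μ • (transversalLeft P D Q E y - y) := by
  obtain ⟨hδ, hη⟩ := hy
  refine ⟨-det3 E (y - Q) D / det3 E (P - y) D, ?_⟩
  -- Expand `y - Q` in the basis `E`, `P - y`, `D`. Removing the `E` component gives the right
  -- point, and what is left is a multiple of the vector from `y` to the left point.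
  have h := det3_cramer E (P - y) D (y - Q)
  rw [transversalRight, transversalLeft]
  have h' : y - Q = (det3 (y - Q) (P - y) D / det3 E (P - y) D) • E +
      (det3 E (y - Q) D / det3 E (P - y) D) • (P - y) +
      (det3 E (P - y) (y - Q) / det3 E (P - y) D) • D := by
    rw [← smul_right_injective E3 hδ |>.eq_iff]
    simp only [smul_add, smul_smul, mul_div_cancel₀ _ hδ]
    exact h
  have e : det3 E (P - y) (y - Q) / det3 E (P - y) D =
      det3 E (y - Q) D / det3 E (P - y) D *
        (det3 E (P - y) (y - Q) / det3 E (y - Q) D) := by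
    field_simp
  rw [e] at h'
  rw [← sub_eq_zero] at h' ⊢
  rw [← neg_zero, ← h', neg_div]
  module

end Transversal

/-! ### The curve near one of its points -/

section Interior

variable {n : ℕ} [NeZero n] {v : Fin n → E3}

open Filter Topology

lemma eventually_mem_edge (hn : 3 ≤ n) (hv : IsNondegenerate v) {j : Fin n} {w : E3}
    (hw : w ∈ edge v j) (hw' : ∀ i, w ≠ v i) : ∀ᶠ y in 𝓝 w, y ∈ curve v → y ∈ edge v j := by
  have h : ∀ᶠ y in 𝓝 w, ∀ i, i ≠ j → y ∉ edge v i := by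
    rw [eventually_all]
    intro i
    by_cases hij : i = j
    · simp [hij]
    have : w ∉ edge v i := fun h => hij (eq_of_mem_edge_of_ne hn hv h hw hw')
    filter_upwards [(isClosed_edge i).isOpen_compl.mem_nhds this] with y hy _ using hy
  filter_upwards [h] with y hy hyK
  obtain ⟨i, hi⟩ := mem_curve.1 hyK
  by_cases hij : i = j
  · exact hij ▸ hi
  · exact (hy i hij hi).elim

lemma exists_edge_functional (hn : 3 ≤ n) (hv : IsNondegenerate v) (j : Fin n) :
    ∃ φ : E3 →L[ℝ] ℝ, φ (v (j + 1) - v j) = 1 :=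
  SeparatingDual.exists_eq_one fun h =>
    ne_add_one hn j (vertex_injective hn hv (sub_eq_zero.1 h)).symm

lemma edge_parameter_mem_Ioo {j : Fin n} {t : ℝ} (h0 : 0 ≤ t) (h1 : t ≤ 1)
    (hw : ∀ i, pt v j t ≠ v i) : 0 < t ∧ t < 1 := by
  refine ⟨lt_of_le_of_ne h0 ?_, lt_of_le_of_ne h1 ?_⟩
  · rintro rfl
    exact hw j (pt_zero v j)
  · rintro rfl
    exact hw (j + 1) (pt_one v j)

/-- The transversal formulas only produce points on lines; near a non-vertex these points are on the
edge itself. -/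
lemma eventually_pt_mem_edge (hn : 3 ≤ n) (hv : IsNondegenerate v) {j : Fin n} {w : E3}
    (hw : w ∈ edge v j) (hw' : ∀ i, w ≠ v i) :
    ∀ᶠ y in 𝓝 w, ∀ t, y = pt v j t → y ∈ edge v j := by
  obtain ⟨φ, hφ⟩ := exists_edge_functional hn hv j
  obtain ⟨t, h0, h1, rfl⟩ := mem_edge.1 hw
  have hφ' : ∀ t, φ (pt v j t - v j) = t := fun t => by simp [pt, map_smul, hφ]
  have hc : ContinuousAt (fun y => φ (y - v j)) (pt v j t) := by fun_prop
  have := hc.eventually (Ioo_mem_nhds (a := 0) (b := 1) (by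
    simpa [hφ'] using (edge_parameter_mem_Ioo h0 h1 hw').1) (by
    simpa [hφ'] using (edge_parameter_mem_Ioo h0 h1 hw').2))
  filter_upwards [this] with y hy s hs
  rw [hs, hφ'] at hy
  exact mem_edge.2 ⟨s, hy.1.le, hy.2.le, hs⟩

/-- The curve is locally a pair of segments that end at a given point of it. -/
lemma curve_local_structure (hn : 4 ≤ n) (hv : IsNondegenerate v) {w : E3} (hw : w ∈ curve v) :
    ∃ (i j : Fin n) (d₁ d₂ : E3) (φ : E3 →L[ℝ] ℝ) (r : ℝ), 0 < r ∧ φ d₁ = 1 ∧ φ d₂ = 1 ∧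
      (∀ t, -r < t → t ≤ 0 → w + t • d₁ ∈ edge v i) ∧
      (∀ t, 0 ≤ t → t < r → w + t • d₂ ∈ edge v j) ∧
      ∀ᶠ y in 𝓝 w, y ∈ curve v →
        (∃ t : ℝ, t ≤ 0 ∧ y = w + t • d₁) ∨ ∃ t : ℝ, 0 ≤ t ∧ y = w + t • d₂ := by
  have hn3 : 3 ≤ n := by omega
  by_cases hvert : ∃ i, w = v i
  · obtain ⟨i, rfl⟩ := hvert
    obtain ⟨i, rfl⟩ : ∃ j, i = j + 1 := ⟨i - 1, by simp⟩
    have hd : det3 (v (i + 1) - v i) (v (i + 1 + 1) - v (i + 1))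
        (v (i + 1 + 1 + 1) - v (i + 1)) ≠ 0 := by
      have := vol_ne_zero hv (ne_add_one hn3 i) (ne_add_two hn3 i) (ne_add_three hn i)
        (ne_add_one hn3 _) (ne_add_two hn3 _) (ne_add_one hn3 _)
      convert this using 1
      simp only [vol, det3, PiLp.sub_apply]
      ring
    set d₁ := v (i + 1) - v i with hd₁
    set d₂ := v (i + 1 + 1) - v (i + 1) with hd₂
    set z := v (i + 1 + 1 + 1) - v (i + 1) with hz
    -- This functional kills `d₂ - d₁`, hence agrees on `d₁` and `d₂`, where it is normalized to 1.
    -- The vector `z` to a fourth vertex only completes a basis. Both directions follow the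
    -- orientation of the curve, so one functional parametrizes it across the vertex.
    let φ₀ : E3 →ₗ[ℝ] ℝ :=
      { toFun := fun y => det3 y (d₂ - d₁) z / det3 d₁ d₂ z
        map_add' := fun a b => by
          rw [← add_div]
          congr 1
          simp only [det3, PiLp.add_apply]
          ring
        map_smul' := fun a b => by
          rw [RingHom.id_apply, smul_eq_mul, ← mul_div_assoc]
          congr 1
          simp only [det3, PiLp.smul_apply, smul_eq_mul]
          ring }
    refine ⟨i, i + 1, d₁, d₂, LinearMap.toContinuousLinearMap φ₀, 1, one_pos, ?_, ?_, ?_, ?_, ?_⟩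
    · change det3 d₁ (d₂ - d₁) z / det3 d₁ d₂ z = 1
      rw [div_eq_one_iff_eq hd]
      simp only [det3, PiLp.sub_apply]
      ring
    · change det3 d₂ (d₂ - d₁) z / det3 d₁ d₂ z = 1
      rw [div_eq_one_iff_eq hd]
      simp only [det3, PiLp.sub_apply]
      ring
    · intro t h1 h2
      refine mem_edge.2 ⟨1 + t, by linarith, by linarith, ?_⟩
      rw [pt, hd₁]
      module
    · intro t h1 h2
      exact mem_edge.2 ⟨t, h1, h2.le, rfl⟩
    · have h : ∀ᶠ y in 𝓝 (v (i + 1)), ∀ k, k ≠ i → k ≠ i + 1 → y ∉ edge v k := by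
        rw [eventually_all]
        intro k
        by_cases hk : v (i + 1) ∈ edge v k
        · rcases vertex_mem_edge hn3 hv hk with h | h
          · simp [h]
          · simp [add_right_cancel h]
        · filter_upwards [(isClosed_edge k).isOpen_compl.mem_nhds hk] with y hy _ _ using hy
      filter_upwards [h] with y hy hyK
      obtain ⟨k, hk⟩ := mem_curve.1 hyK
      obtain ⟨t, h0, h1, ht⟩ := mem_edge.1 hk
      by_cases hki : k = i
      · subst hki
        refine Or.inl ⟨t - 1, by linarith, ?_⟩
        rw [ht, pt, hd₁]
        module
      · by_cases hki' : k = i + 1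
        · subst hki'
          exact Or.inr ⟨t, h0, ht⟩
        · exact (hy k hki hki' hk).elim
  · push Not at hvert
    obtain ⟨j, hj⟩ := mem_curve.1 hw
    obtain ⟨φ, hφ⟩ := exists_edge_functional hn3 hv j
    have hloc := eventually_mem_edge hn3 hv hj hvert
    obtain ⟨t, h0, h1, rfl⟩ := mem_edge.1 hj
    obtain ⟨h0', h1'⟩ := edge_parameter_mem_Ioo h0 h1 hvert
    have hadd : ∀ s, pt v j t + s • (v (j + 1) - v j) = pt v j (t + s) := fun s => by
      rw [pt, pt]; module
    refine ⟨j, j, v (j + 1) - v j, v (j + 1) - v j, φ, min t (1 - t), lt_min h0' (by linarith),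
      hφ, hφ, ?_, ?_, ?_⟩
    · intro s h2 h3
      have := min_le_left t (1 - t)
      exact mem_edge.2 ⟨t + s, by linarith, by linarith, hadd s⟩
    · intro s h2 h3
      have := min_le_right t (1 - t)
      exact mem_edge.2 ⟨t + s, by linarith, by linarith, hadd s⟩
    · filter_upwards [hloc] with y hy hyK
      obtain ⟨s, -, -, hs⟩ := mem_edge.1 (hy hyK)
      have hs' : y = pt v j t + (s - t) • (v (j + 1) - v j) := by
        rw [hadd, hs]; congr 1; ring
      rcases le_total (s - t) 0 with h | h
      · exact Or.inl ⟨_, h, hs'⟩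
      · exact Or.inr ⟨_, h, hs'⟩

end Interior

/-! ### Open arcs of trisecants -/

section InteriorArcs

variable {n : ℕ} [NeZero n] {v : Fin n → E3}

open Filter Topology

/-- In a strictly convex space, betweenness is equality in the triangle inequality. -/
lemma isClosed_wbtw (a b c : Fin 3) :
    IsClosed {y : Fin 3 → E3 | Wbtw ℝ (y a) (y b) (y c)} := by
  simp_rw [← dist_add_dist_eq_iff]
  exact isClosed_eq (by fun_prop) (by fun_prop)

/-- A collinear triple of points of the curve near a trisecant is a trisecant. -/
lemma eventually_mem_trisecants (hn : 3 ≤ n) (hv : IsNondegenerate v) {x : Fin 3 → E3}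
    (hx : x ∈ trisecants (curve v)) :
    ∀ᶠ y in 𝓝 x, (∀ a, y a ∈ curve v) → Collinear ℝ (Set.range y) →
      y ∈ trisecants (curve v) := by
  have h1 : ∀ᶠ y in 𝓝 x, ∀ a b, a ≠ b → ∀ i, y a ∈ edge v i → y b ∉ edge v i := by
    simp only [eventually_all]
    intro a b hab i
    have hc : IsClosed {y : Fin 3 → E3 | y a ∈ edge v i ∧ y b ∈ edge v i} :=
      ((isClosed_edge i).preimage (by fun_prop : Continuous fun y : Fin 3 → E3 => y a)).inter
        ((isClosed_edge i).preimage (by fun_prop : Continuous fun y : Fin 3 → E3 => y b))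
    have := hc.isOpen_compl.mem_nhds (x := x)
      fun h => trisecants_not_mem_edge hx hab h.1 h.2
    filter_upwards [this] with y hy ha hb using hy ⟨ha, hb⟩
  have hw := ((mem_trisecants_iff hn hv).1 hx).2.2
  -- The two other orders are closed conditions that fail at `x`, whose points are distinct; so the
  -- order persists nearby.
  have h2 : ∀ᶠ y in 𝓝 x, ¬ Wbtw ℝ (y 1) (y 2) (y 0) := by
    refine (isClosed_wbtw 1 2 0).isOpen_compl.mem_nhds (x := x) fun h => ?_
    exact trisecants_ne hx (a := 1) (b := 2) (by decide) (hw.symm.swap_left_iff.1 h).symm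
  have h3 : ∀ᶠ y in 𝓝 x, ¬ Wbtw ℝ (y 2) (y 0) (y 1) := by
    refine (isClosed_wbtw 2 0 1).isOpen_compl.mem_nhds (x := x) fun h => ?_
    exact trisecants_ne hx (a := 0) (b := 1) (by decide) (hw.swap_left_iff.1 (Wbtw.symm h))
  filter_upwards [h1, h2, h3] with y h1 h2 h3 hK hcol
  refine (mem_trisecants_iff hn hv).2 ⟨hK, h1, ?_⟩
  have hr : Set.range y = {y 0, y 1, y 2} := by
    ext z
    simp [Fin.exists_fin_succ, eq_comm]
  rw [hr] at hcol
  rcases hcol.wbtw_or_wbtw_or_wbtw with h | h | h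
  · exact h
  · exact (h2 h).elim
  · exact (h3 h).elim

lemma collinear_of_sub_eq_smul {y : Fin 3 → E3} {s m k : Fin 3} (hsm : s ≠ m) (hsk : s ≠ k)
    (hmk : m ≠ k) {μ : ℝ} (h : y k - y s = μ • (y m - y s)) : Collinear ℝ (Set.range y) := by
  refine (collinear_iff_exists_forall_eq_smul_vadd _).2 ⟨y s, y m - y s, ?_⟩
  rintro _ ⟨a, rfl⟩
  have ha : a = s ∨ a = m ∨ a = k := by omega
  rcases ha with rfl | rfl | rfl
  · exact ⟨0, by simp⟩
  · exact ⟨1, by simp⟩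
  · exact ⟨μ, by rw [← h, vadd_eq_add, sub_add_cancel]⟩

/-- Near a given trisecant, the set of trisecants is a graph over the curve. -/
lemma trisecants_local_graph (hn : 3 ≤ n) (hv : IsNondegenerate v) {x : Fin 3 → E3}
    (hx : x ∈ trisecants (curve v)) {s m k : Fin 3} (hsm : s ≠ m) (hsk : s ≠ k) (hmk : m ≠ k)
    {j l : Fin n} (hj : x m ∈ edge v j) (hl : x k ∈ edge v l) (hjl : Apart j l)
    (hm : ∀ i, x m ≠ v i) (hk : ∀ i, x k ≠ v i) :
    ∃ (N : Set E3) (g h : E3 → E3), IsOpen N ∧ x s ∈ N ∧ ContDiffOn ℝ ∞ g N ∧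
      ContDiffOn ℝ ∞ h N ∧ ∀ᶠ y in 𝓝 x,
        (y ∈ trisecants (curve v) ↔ y s ∈ curve v ∧ y m = g (y s) ∧ y k = h (y s)) ∧
        (y ∈ trisecants (curve v) → y m ∈ edge v j ∧ y k ∈ edge v l) := by
  set P := v j
  set D := v (j + 1) - v j with hD
  set Q := v l
  set E := v (l + 1) - v l with hE
  have hmu : ∀ {y}, y ∈ trisecants (curve v) → y m ∈ edge v j → y k ∈ edge v l →
      ∃ b c μ : ℝ, μ ≠ 0 ∧ y m = P + b • D ∧ y k = Q + c • E ∧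
        Q + c • E - y s = μ • (P + b • D - y s) := by
    intro y hy hym hyk
    obtain ⟨b, -, -, hb⟩ := mem_edge.1 hym
    obtain ⟨c, -, -, hc⟩ := mem_edge.1 hyk
    obtain ⟨μ, hμ⟩ := exists_eq_add_smul_of_collinear (trisecants_collinear hy)
      (trisecants_ne hy hsm) k
    refine ⟨b, c, μ, ?_, hb, hc, ?_⟩
    · rintro rfl
      rw [zero_smul, sub_eq_zero] at hμ
      exact trisecants_ne hy hsk hμ.symm
    · rw [hb, hc] at hμ
      exact hμ
  have hN : x s ∈ transversalDomain P D Q E := by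
    obtain ⟨b, c, μ, hμ, -, -, h⟩ := hmu hx hj hl
    exact mem_transversalDomain (det3_ne_zero_of_apart hn hv hjl) hμ h
  refine ⟨transversalDomain P D Q E, transversalLeft P D Q E, transversalRight P D Q E,
    isOpen_transversalDomain P D Q E, hN, contDiffOn_transversalLeft P D Q E,
    contDiffOn_transversalRight P D Q E, ?_⟩
  have e1 : ∀ᶠ y in 𝓝 x, y s ∈ transversalDomain P D Q E :=
    (continuous_apply s).continuousAt.eventually_mem
      ((isOpen_transversalDomain P D Q E).mem_nhds hN)
  have e2 := (continuous_apply m).continuousAt.eventually (eventually_mem_edge hn hv hj hm)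
  have e3 := (continuous_apply k).continuousAt.eventually (eventually_mem_edge hn hv hl hk)
  have e4 := (continuous_apply m).continuousAt.eventually (eventually_pt_mem_edge hn hv hj hm)
  have e5 := (continuous_apply k).continuousAt.eventually (eventually_pt_mem_edge hn hv hl hk)
  filter_upwards [e1, e2, e3, e4, e5, eventually_mem_trisecants hn hv hx]
    with y h1 h2 h3 h4 h5 h6
  refine ⟨⟨fun hy => ?_, ?_⟩, fun hy => ⟨h2 (hy.mem m), h3 (hy.mem k)⟩⟩
  · obtain ⟨b, c, μ, -, hb, hc, h⟩ := hmu hy (h2 (hy.mem m)) (h3 (hy.mem k))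
    have := eq_transversal h1 h
    exact ⟨hy.mem s, hb.trans this.1, hc.trans this.2⟩
  -- The formulas yield a collinear triple on the right lines; nearness puts its points on the edges
  -- and makes it a trisecant.
  · rintro ⟨hs, hym, hyk⟩
    obtain ⟨μ, hμ⟩ := exists_transversal h1
    rw [← hym, ← hyk] at hμ
    refine h6 (fun a => ?_) (collinear_of_sub_eq_smul hsm hsk hmk hμ)
    have ha : a = s ∨ a = m ∨ a = k := by omega
    rcases ha with rfl | rfl | rfl
    · exact hs
    · exact mem_curve.2 ⟨j, h4 _ hym⟩
    · exact mem_curve.2 ⟨l, h5 _ hyk⟩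

/-- Near a trisecant, the set of trisecants is a piecewise smooth open arc. -/
theorem trisecants_openArc (hn : 4 ≤ n) (hv : IsNondegenerate v) {x : Fin 3 → E3}
    (hx : x ∈ trisecants (curve v)) {M : Set (Fin 3 → E3)}
    (hM : ∀ᶠ y in 𝓝 x, y ∈ M ↔ y ∈ trisecants (curve v)) :
    ∃ γ : ℝ → Fin 3 → E3, γ 0 = x ∧
      Topology.IsEmbedding ((Set.Ioo (-1 : ℝ) 1).domRestrict γ) ∧
      (∃ U, IsOpen U ∧ γ '' Set.Ioo (-1 : ℝ) 1 = M ∩ U) ∧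
      IsSmoothPiece (cubes v) γ (Set.Ioc (-1 : ℝ) 0) ∧
      IsSmoothPiece (cubes v) γ (Set.Ico (0 : ℝ) 1) := by
  have hn3 : 3 ≤ n := by omega
  obtain ⟨s, m, k, hsm, hsk, hmk, j, l, hj, hl, hjl, hm, hk⟩ := exists_apart hn hv hx
  obtain ⟨N, g, h, hN, hxN, hg, hh, hloc⟩ :=
    trisecants_local_graph hn3 hv hx hsm hsk hmk hj hl hjl hm hk
  obtain ⟨i, i', d₁, d₂, φ, r₁, hr₁, hφ₁, hφ₂, hi, hi', hcurve⟩ :=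
    curve_local_structure hn hv (hx.mem s)
  set w := x s with hw
  have hex : ∀ a, a = s ∨ a = m ∨ a = k := fun a => by omega
  let G : E3 → Fin 3 → E3 := fun y a => if a = s then y else if a = m then g y else h y
  have hGs : ∀ y, G y s = y := fun y => by simp [G]
  have hGm : ∀ y, G y m = g y := fun y => by simp [G, hsm.symm]
  have hGk : ∀ y, G y k = h y := fun y => by simp [G, hsk.symm, hmk.symm]
  have hG : ∀ y : Fin 3 → E3, y m = g (y s) → y k = h (y s) → y = G (y s) := by
    intro y h1 h2
    funext a
    rcases hex a with rfl | rfl | rfl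
    · rw [hGs]
    · rw [hGm, h1]
    · rw [hGk, h2]
  have hGN : ContDiffOn ℝ ∞ G N := by
    rw [contDiffOn_pi]
    intro a
    rcases hex a with rfl | rfl | rfl
    · simpa only [hGs] using contDiff_fun_id.contDiffOn
    · simpa only [hGm] using hg
    · simpa only [hGk] using hh
  have hGw : G w = x := by
    have := (hloc.self_of_nhds.1.1 hx).2
    exact (hG x this.1 this.2).symm
  -- A path along the curve through `w` that may bend at `t = 0`, with `φ (κ t - w) = t` throughout.
  -- The arc is its lift by the graph map `G`, smooth on each closed half.
  let κ : ℝ → E3 := fun t => w + (min t 0) • d₁ + (max t 0) • d₂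
  have hκl : ∀ t ≤ 0, κ t = w + t • d₁ := fun t ht => by simp [κ, ht]
  have hκr : ∀ t, 0 ≤ t → κ t = w + t • d₂ := fun t ht => by simp [κ, ht]
  have hκ0 : κ 0 = w := by simp [κ]
  have hκ : Continuous κ := by fun_prop
  have hφκ : ∀ t, φ (κ t - w) = t := by
    intro t
    simp only [κ, map_sub, map_add, map_smul, hφ₁, hφ₂, smul_eq_mul, mul_one]
    linarith [min_add_max t 0]
  have hev : ∀ᶠ y in 𝓝 x, (y ∈ M ↔ y s ∈ curve v ∧ y m = g (y s) ∧ y k = h (y s)) ∧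
      (y ∈ M → y m ∈ edge v j ∧ y k ∈ edge v l) ∧
      (y s ∈ curve v → κ (φ (y s - w)) = y s) := by
    filter_upwards [hM, hloc, (continuous_apply s).continuousAt.eventually hcurve]
      with y h1 h2 h3
    refine ⟨h1.trans h2.1, fun hy => h2.2 (h1.1 hy), fun hy => ?_⟩
    rcases h3 hy with ⟨t, ht, hyt⟩ | ⟨t, ht, hyt⟩
    · rw [hyt, ← hκl t ht, hφκ]
    · rw [hyt, ← hκr t ht, hφκ]
  obtain ⟨U₀, hU₀, hU₀o, hxU₀⟩ := eventually_nhds_iff.1 hev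
  have hγc : ContinuousAt (fun t => G (κ t)) 0 := by
    refine ContinuousAt.comp (g := G) ?_ hκ.continuousAt
    rw [hκ0]
    exact hGN.continuousOn.continuousAt (hN.mem_nhds hxN)
  have hnear : ∀ᶠ t in 𝓝 (0 : ℝ), G (κ t) ∈ U₀ ∧ κ t ∈ N := by
    refine (hγc.eventually_mem ?_).and (hκ.continuousAt.eventually_mem ?_)
    · rw [hκ0, hGw]
      exact hU₀o.mem_nhds hxU₀
    · rw [hκ0]
      exact hN.mem_nhds hxN
  obtain ⟨r₂, hr₂, hr₂'⟩ := Metric.eventually_nhds_iff.1 hnear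
  set r := min r₁ r₂ with hr
  have hr0 : 0 < r := lt_min hr₁ hr₂
  have hrl : r ≤ r₁ := min_le_left _ _
  have hrr : r ≤ r₂ := min_le_right _ _
  have hin : ∀ t ∈ Set.Ioo (-r) r, G (κ t) ∈ U₀ ∧ κ t ∈ N := by
    intro t ht
    apply hr₂'
    rw [Real.dist_eq, sub_zero, abs_lt]
    exact ⟨by linarith [ht.1], by linarith [ht.2]⟩
  have hκK : ∀ t ∈ Set.Ioo (-r) r, κ t ∈ curve v := by
    intro t ht
    rcases le_total t 0 with h0 | h0
    · rw [hκl t h0]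
      exact mem_curve.2 ⟨i, hi t (by linarith [ht.1]) h0⟩
    · rw [hκr t h0]
      exact mem_curve.2 ⟨i', hi' t h0 (by linarith [ht.2])⟩
  have hγM : ∀ t ∈ Set.Ioo (-r) r, G (κ t) ∈ M := by
    intro t ht
    rw [(hU₀ _ (hin t ht).1).1, hGs, hGm, hGk]
    exact ⟨hκK t ht, rfl, rfl⟩
  have hcell : ∀ (I : Set ℝ) (p : Fin n), I ⊆ Set.Ioo (-r) r → (∀ t ∈ I, κ t ∈ edge v p) →
      ∃ C ∈ cubes v, Set.MapsTo (fun t => G (κ t)) I C := by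
    intro I p hI hp
    refine ⟨_, ⟨fun a => if a = s then p else if a = m then j else l, rfl⟩, fun t ht a => ?_⟩
    have := (hU₀ _ (hin t (hI ht)).1).2.1 (hγM t (hI ht))
    rcases hex a with rfl | rfl | rfl
    · simpa [hGs] using hp t ht
    · simpa [hsm.symm] using this.1
    · simpa [hsk.symm, hmk.symm] using this.2
  have hIl : Set.Ioc (-r) 0 ⊆ Set.Ioo (-r) r := fun t ht => ⟨ht.1, ht.2.trans_lt hr0⟩
  have hIr : Set.Ico 0 r ⊆ Set.Ioo (-r) r := fun t ht => ⟨by linarith [ht.1], ht.2⟩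
  have main := exists_openArc (cells := cubes v) (M := M) (γ := fun t => G (κ t)) hr0
    (φ.comp (ContinuousLinearMap.proj s)) ?_ ?_ ?_ ?_ ?_ ?_ ?_
  · simpa only [hκ0, hGw] using main
  · intro t _
    have := hφκ t
    rw [map_sub] at this
    simp only [ContinuousLinearMap.comp_apply, ContinuousLinearMap.proj_apply, hGs, hκ0]
    linarith
  · exact hGN.continuousOn.comp hκ.continuousOn fun t ht => (hin t ht).2
  -- Within `U₀` the parameter of a point of `M` is recovered by `φ`, so restricting its value cuts
  -- out exactly the arc.
  · refine ⟨U₀ ∩ {y | φ (y s - w) ∈ Set.Ioo (-r) r}, hU₀o.inter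
      (isOpen_Ioo.preimage (by fun_prop)), ?_⟩
    ext y
    constructor
    · rintro ⟨t, ht, rfl⟩
      refine ⟨hγM t ht, (hin t ht).1, ?_⟩
      simpa only [Set.mem_ofPred_eq, hGs, hφκ] using ht
    · rintro ⟨hyM, hyU, hyr⟩
      obtain ⟨hyK, hym, hyk⟩ := (hU₀ y hyU).1.1 hyM
      refine ⟨φ (y s - w), hyr, ?_⟩
      change G (κ (φ (y s - w))) = y
      rw [(hU₀ y hyU).2.2 hyK]
      exact (hG y hym hyk).symm
  · refine (hGN.comp (f := fun t => w + t • d₁) (s := Set.Ioc (-r) 0)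
      (ContDiff.contDiffOn (by fun_prop)) fun t ht => ?_).congr fun t ht => ?_
    · change w + t • d₁ ∈ N
      rw [← hκl t ht.2]
      exact (hin t (hIl ht)).2
    · rw [Function.comp_apply, hκl t ht.2]
  · refine (hGN.comp (f := fun t => w + t • d₂) (s := Set.Ico 0 r)
      (ContDiff.contDiffOn (by fun_prop)) fun t ht => ?_).congr fun t ht => ?_
    · change w + t • d₂ ∈ N
      rw [← hκr t ht.1]
      exact (hin t (hIr ht)).2
    · rw [Function.comp_apply, hκr t ht.1]
  · refine hcell _ i hIl fun t ht => ?_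
    rw [hκl t ht.2]
    exact hi t (by linarith [ht.1]) ht.2
  · refine hcell _ i' hIr fun t ht => ?_
    rw [hκr t ht.1]
    exact hi' t ht.1 (by linarith [ht.2])

end InteriorArcs

/-! ### Half-open arcs of trisecants at a corner -/

section Corners

variable {n : ℕ} [NeZero n] {v : Fin n → E3}

open Filter Topology

/-- The two edges `e` and `e'` that are incident to the vertex `v (i + 1)`, in either order, with
direction vectors pointing away from the vertex. -/
structure IsCorner (v : Fin n → E3) (i e e' : Fin n) (X Y : E3) : Prop where
  ne : e ≠ e'
  mem_left : ∀ y, y ∈ edge v e ↔ ∃ a : ℝ, 0 ≤ a ∧ a ≤ 1 ∧ y = v (i + 1) + a • X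
  mem_right : ∀ y, y ∈ edge v e' ↔ ∃ a : ℝ, 0 ≤ a ∧ a ≤ 1 ∧ y = v (i + 1) + a • Y
  indep : ∀ s t : ℝ, s • X + t • Y = 0 → s = 0 ∧ t = 0
  vol_eq_zero : ∀ s t : ℝ,
    vol (v i) (v (i + 1)) (v (i + 1 + 1)) (v (i + 1) + s • X + t • Y) = 0
  eq_or_eq : ∀ k, v (i + 1) ∈ edge v k → k = e ∨ k = e'
  eq_left_or_eq_right : ∀ k, k = i ∨ k = i + 1 → k = e ∨ k = e'
  directions : (X = v i - v (i + 1) ∧ Y = v (i + 1 + 1) - v (i + 1)) ∨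
    (Y = v i - v (i + 1) ∧ X = v (i + 1 + 1) - v (i + 1))
  interior_left : ∀ a : ℝ, 0 < a → a < 1 → ∀ l, v (i + 1) + a • X ≠ v l
  interior_right : ∀ a : ℝ, 0 < a → a < 1 → ∀ l, v (i + 1) + a • Y ≠ v l
  vertex_mem : ∀ l, l = i ∨ l = i + 1 ∨ l = i + 1 + 1 → v l ∈ edge v e ∨ v l ∈ edge v e'

lemma IsCorner.symm {i e e' : Fin n} {X Y : E3} (h : IsCorner v i e e' X Y) :
    IsCorner v i e' e Y X where
  ne := h.ne.symm
  mem_left := h.mem_right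
  mem_right := h.mem_left
  indep s t hst := (h.indep t s (by rw [add_comm]; exact hst)).symm
  vol_eq_zero s t := by
    have := h.vol_eq_zero t s
    rwa [add_right_comm (v (i + 1))] at this
  eq_or_eq k hk := (h.eq_or_eq k hk).symm
  directions := h.directions.symm
  interior_left := h.interior_right
  interior_right := h.interior_left
  eq_left_or_eq_right k hk := (h.eq_left_or_eq_right k hk).symm
  vertex_mem l hl := (h.vertex_mem l hl).symm

lemma pt_ne_vertex (hn : 3 ≤ n) (hv : IsNondegenerate v) (i : Fin n) {t : ℝ} (h0 : 0 < t)
    (h1 : t < 1) (l : Fin n) : pt v i t ≠ v l := by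
  intro h
  rw [← pt_zero v l] at h
  by_cases hil : i = l
  · subst hil
    exact h0.ne' (pt_injective hn hv h)
  · rcases pt_eq_pt hn hv hil h with ⟨-, h, -⟩ | ⟨-, h, -⟩
    · exact h1.ne h
    · exact h0.ne' h

lemma isCorner (hn : 3 ≤ n) (hv : IsNondegenerate v) (i : Fin n) :
    IsCorner v i i (i + 1) (v i - v (i + 1)) (v (i + 1 + 1) - v (i + 1)) where
  ne := ne_add_one hn i
  mem_left y := by
    rw [mem_edge]
    constructor
    · rintro ⟨t, h0, h1, rfl⟩
      exact ⟨1 - t, by linarith, by linarith, by rw [pt]; module⟩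
    · rintro ⟨t, h0, h1, rfl⟩
      exact ⟨1 - t, by linarith, by linarith, by rw [pt]; module⟩
  mem_right y := mem_edge
  indep s t h := eq_zero_of_smul_add_smul hv (ne_add_one hn i).symm (ne_add_one hn (i + 1))
    (ne_add_two hn i) h
  vol_eq_zero s t := by
    simp only [vol, det3, PiLp.sub_apply, PiLp.add_apply, PiLp.smul_apply, smul_eq_mul]
    ring
  eq_or_eq k hk := by
    rcases vertex_mem_edge hn hv hk with h | h
    · exact Or.inr h.symm
    · exact Or.inl (add_right_cancel h).symm
  eq_left_or_eq_right k hk := hk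
  directions := Or.inl ⟨rfl, rfl⟩
  interior_left a h0 h1 l := by
    have := pt_ne_vertex hn hv i (t := 1 - a) (by linarith) (by linarith) l
    convert this using 1
    rw [pt]
    module
  interior_right a h0 h1 l := pt_ne_vertex hn hv (i + 1) h0 h1 l
  vertex_mem l hl := by
    rcases hl with rfl | rfl | rfl
    · exact Or.inl (left_mem_edge _)
    · exact Or.inl (right_mem_edge _)
    · exact Or.inr (right_mem_edge _)

/-- Two different edges with a common point form a corner at that point. -/
lemma exists_isCorner (hn : 3 ≤ n) (hv : IsNondegenerate v) {e e' : Fin n} (he : e ≠ e') {y : E3}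
    (hy : y ∈ edge v e) (hy' : y ∈ edge v e') :
    ∃ i X Y, IsCorner v i e e' X Y ∧ y = v (i + 1) := by
  obtain ⟨s, -, -, hs⟩ := mem_edge.1 hy
  obtain ⟨t, -, -, ht⟩ := mem_edge.1 hy'
  rcases pt_eq_pt hn hv he (hs.symm.trans ht) with ⟨rfl, rfl, rfl⟩ | ⟨rfl, rfl, rfl⟩
  · exact ⟨e, _, _, isCorner hn hv e, by rw [hs, pt_one]⟩
  · exact ⟨e', _, _, (isCorner hn hv e').symm, by rw [ht, pt_one]⟩

lemma wbtw_of_mem_trisecants (hn : 3 ≤ n) (hv : IsNondegenerate v) {y : Fin 3 → E3}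
    (hy : y ∈ trisecants (curve v)) {c c' : Fin 3} (hc : c ≠ 1) (hc' : c' ≠ 1) (hcc : c ≠ c') :
    Wbtw ℝ (y c) (y 1) (y c') := by
  have h := ((mem_trisecants_iff hn hv).1 hy).2.2
  have : (c = 0 ∧ c' = 2) ∨ (c = 2 ∧ c' = 0) := by omega
  rcases this with ⟨rfl, rfl⟩ | ⟨rfl, rfl⟩
  · exact h
  · exact h.symm

/-- The trisecants that meet both edges of a corner end outside the double wedge. -/
lemma IsCorner.trisecant (hn : 3 ≤ n) (hv : IsNondegenerate v) {i e e' : Fin n} {X Y : E3}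
    (h : IsCorner v i e e' X Y) {y : Fin 3 → E3} (hy : y ∈ trisecants (curve v)) {c c' : Fin 3}
    (hc : c ≠ 1) (hc' : c' ≠ 1) (hcc : c ≠ c') (hyc : y c ∈ edge v e) (hy1 : y 1 ∈ edge v e') :
    ∃ a b σ τ : ℝ, 0 < a ∧ σ < 0 ∧ 0 < τ ∧ y c = v (i + 1) + a • X ∧ y 1 = v (i + 1) + b • Y ∧
      y c' = v (i + 1) + σ • X + τ • Y ∧ (a - σ) * b = τ * a := by
  obtain ⟨a, ha0, ha1, ha⟩ := (h.mem_left _).1 hyc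
  obtain ⟨b, hb0, hb1, hb⟩ := (h.mem_right _).1 hy1
  have ha0' : 0 < a := by
    refine lt_of_le_of_ne ha0 ?_
    rintro rfl
    exact trisecants_not_mem_edge hy hc.symm hy1
      ((h.mem_right _).2 ⟨0, le_rfl, zero_le_one, by rw [ha]; simp⟩)
  have hb0' : 0 < b := by
    refine lt_of_le_of_ne hb0 ?_
    rintro rfl
    exact trisecants_not_mem_edge hy hc hyc
      ((h.mem_left _).2 ⟨0, le_rfl, zero_le_one, by rw [hb]; simp⟩)
  obtain ⟨r, ⟨hr0, hr1⟩, hr⟩ := wbtw_of_mem_trisecants hn hv hy hc hc' hcc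
  have hr0' : 0 < r := by
    refine lt_of_le_of_ne hr0 ?_
    rintro rfl
    exact trisecants_ne hy hc (by simpa using hr)
  have hr1' : r < 1 := by
    refine lt_of_le_of_ne hr1 ?_
    rintro rfl
    exact trisecants_ne hy hc' (by simpa using hr)
  -- Solve `y 1 = (1 - r) y c + r y c'` for `y c'`; since `0 < r < 1`, the coefficients have
  -- opposite signs. The last relation says that `(a, 0)`, `(0, b)` and `(σ, τ)` are collinear.
  refine ⟨a, b, a * (1 - r⁻¹), b * r⁻¹, ha0', ?_, by positivity, ha, hb, ?_, ?_⟩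
  · have := (one_lt_inv₀ hr0').2 hr1'
    nlinarith
  · rw [AffineMap.lineMap_apply_module'] at hr
    have h2 : y c' = y c + r⁻¹ • (y 1 - y c) := by
      rw [← hr, add_sub_cancel_right, smul_smul, inv_mul_cancel₀ hr0'.ne', one_smul,
        add_sub_cancel]
    rw [h2, ha, hb]
    module
  · ring

/-- An edge that does not belong to a corner meets its plane at most once. -/
lemma IsCorner.eq_of_mem_edge (hn : 4 ≤ n) (hv : IsNondegenerate v) {i e e' : Fin n} {X Y : E3}
    (h : IsCorner v i e e' X Y) {k : Fin n} (hk : k ≠ e) (hk' : k ≠ e') {y z : E3}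
    (hy : y ∈ edge v k) (hz : z ∈ edge v k)
    (hy0 : vol (v i) (v (i + 1)) (v (i + 1 + 1)) y = 0)
    (hz0 : vol (v i) (v (i + 1)) (v (i + 1 + 1)) z = 0) : y = z := by
  have hn3 : 3 ≤ n := by omega
  obtain ⟨s, -, -, rfl⟩ := mem_edge.1 hy
  obtain ⟨t, -, -, rfl⟩ := mem_edge.1 hz
  rw [vol_pt] at hy0 hz0
  have hki : ¬ (k = i ∨ k = i + 1) := fun hki => by
    rcases h.eq_left_or_eq_right k hki with h | h
    · exact hk h
    · exact hk' h
  by_cases hst : s = t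
  · rw [hst]
  exfalso
  have h1 : (s - t) * (vol (v i) (v (i + 1)) (v (i + 1 + 1)) (v (k + 1)) -
      vol (v i) (v (i + 1)) (v (i + 1 + 1)) (v k)) = 0 := by linear_combination hy0 - hz0
  have h2 := (mul_eq_zero.1 h1).resolve_left (sub_ne_zero.2 hst)
  have h3 : vol (v i) (v (i + 1)) (v (i + 1 + 1)) (v k) = 0 := by
    linear_combination hy0 - s * h2
  have h4 : vol (v i) (v (i + 1)) (v (i + 1 + 1)) (v (k + 1)) = 0 := by
    linear_combination h2 + h3
  -- Two points in the plane force both endpoints of the edge into it. They are then vertices of the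
  -- corner, which leaves only `k = i + 1 + 1`, and its other endpoint is a fourth vertex.
  have h5 : k = i + 1 + 1 := by
    rcases mem_of_vol_eq_zero hn3 hv h3 with h | h | h
    · exact (hki (Or.inl h)).elim
    · exact (hki (Or.inr h)).elim
    · exact h
  subst h5
  rcases mem_of_vol_eq_zero hn3 hv h4 with h | h | h
  · exact ne_add_three hn i h.symm
  · exact ne_add_two hn3 (i + 1) h.symm
  · exact ne_add_one hn3 (i + 1 + 1) h.symm

/-- A point of the curve in the plane of a corner and outside of its double wedge. -/
structure IsOutside (v : Fin n → E3) (i : Fin n) (X Y : E3) (σ τ : ℝ) (k : Fin n) (p : E3) :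
    Prop where
  neg : σ < 0
  pos : 0 < τ
  mem : p ∈ edge v k
  eq : p = v (i + 1) + σ • X + τ • Y

lemma IsCorner.coeff_eq {i e e' : Fin n} {X Y : E3} (h : IsCorner v i e e' X Y) {w : E3}
    {s t s' t' : ℝ} (heq : w + s • X + t • Y = w + s' • X + t' • Y) : s = s' ∧ t = t' := by
  have h0 : (s - s') • X + (t - t') • Y = 0 := by
    rw [← sub_eq_zero] at heq
    rw [← heq]
    module
  have := h.indep _ _ h0
  exact ⟨by linarith, by linarith⟩

section Arc

variable {i e e' k : Fin n} {X Y p : E3} {σ τ : ℝ}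

lemma IsOutside.not_mem (hp : IsOutside v i X Y σ τ k p) (h : IsCorner v i e e' X Y) :
    p ∉ edge v e ∧ p ∉ edge v e' := by
  constructor
  · intro hpe
    obtain ⟨a, -, -, ha⟩ := (h.mem_left _).1 hpe
    have : v (i + 1) + σ • X + τ • Y = v (i + 1) + a • X + (0 : ℝ) • Y := by
      rw [← hp.eq, ha]; simp
    exact hp.pos.ne' (h.coeff_eq this).2
  · intro hpe
    obtain ⟨a, -, -, ha⟩ := (h.mem_right _).1 hpe
    have : v (i + 1) + σ • X + τ • Y = v (i + 1) + (0 : ℝ) • X + a • Y := by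
      rw [← hp.eq, ha]; simp
    exact hp.neg.ne (h.coeff_eq this).1

lemma IsOutside.vol_eq_zero (hp : IsOutside v i X Y σ τ k p) (h : IsCorner v i e e' X Y) :
    vol (v i) (v (i + 1)) (v (i + 1 + 1)) p = 0 := by
  rw [hp.eq]
  exact h.vol_eq_zero _ _

lemma IsOutside.ne_vertex (hn : 3 ≤ n) (hv : IsNondegenerate v)
    (hp : IsOutside v i X Y σ τ k p) (h : IsCorner v i e e' X Y) (l : Fin n) : p ≠ v l := by
  rintro rfl
  rcases h.vertex_mem l (mem_of_vol_eq_zero hn hv (hp.vol_eq_zero h)) with hl | hl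
  · exact (hp.not_mem h).1 hl
  · exact (hp.not_mem h).2 hl

lemma IsOutside.ne_edge (hp : IsOutside v i X Y σ τ k p) (h : IsCorner v i e e' X Y) :
    k ≠ e ∧ k ≠ e' := by
  constructor
  · rintro rfl
    exact (hp.not_mem h).1 hp.mem
  · rintro rfl
    exact (hp.not_mem h).2 hp.mem

/-- The arc of trisecants that ends at the degenerate trisecant with the points `v (i + 1)`
(twice) and `p`, the latter at position `c'`. -/
def cornerArc (v : Fin n → E3) (i : Fin n) (X Y p : E3) (σ τ : ℝ) (c' : Fin 3) (a : ℝ) :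
    Fin 3 → E3 := fun q =>
  -- The coefficient of `Y` is the `b` solving `(a - σ) * b = τ * a`: there the line through `p` and
  -- `v (i + 1) + a • X` crosses the other edge line.
  if q = c' then p else if q = 1 then v (i + 1) + (τ * a / (a - σ)) • Y else v (i + 1) + a • X

/-- The denominator vanishes only at `a = σ`. For a point outside the wedge `σ < 0`, so the arc is
smooth across its end at `a = 0`. -/
lemma contDiffOn_cornerArc (c' : Fin 3) :
    ContDiffOn ℝ ∞ (cornerArc v i X Y p σ τ c') (Set.Ioi σ) := by
  rw [contDiffOn_pi]
  intro q
  unfold cornerArc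
  split_ifs
  · exact contDiffOn_const
  · have h : ContDiffOn ℝ ∞ (fun a => τ * a / (a - σ)) (Set.Ioi σ) :=
      ContDiffOn.div (by fun_prop) (by fun_prop) fun a ha => (sub_pos.2 ha).ne'
    exact contDiffOn_const.add (h.smul contDiffOn_const)
  · fun_prop

lemma cornerArc_mem_trisecants (hn : 3 ≤ n) (hv : IsNondegenerate v)
    (h : IsCorner v i e e' X Y) (hp : IsOutside v i X Y σ τ k p) {c c' : Fin 3} (hc : c ≠ 1)
    (hc' : c' ≠ 1) (hcc : c ≠ c') {a : ℝ} (ha0 : 0 < a) (ha1 : a < 1) (ha2 : τ * a < -σ) :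
    (∀ q, cornerArc v i X Y p σ τ c' a q ∈
        edge v (if q = c' then k else if q = 1 then e' else e)) ∧
      cornerArc v i X Y p σ τ c' a ∈ trisecants (curve v) := by
  set b := τ * a / (a - σ) with hb
  have hσ := hp.neg
  have hτ := hp.pos
  have haσ : 0 < a - σ := by linarith
  have hb0 : 0 < b := by positivity
  -- The bound `τ * a < -σ` keeps the middle point on the edge `e'`.
  have hb1 : b < 1 := by rw [hb, div_lt_one haσ]; linarith
  have hex : ∀ q, q = c ∨ q = 1 ∨ q = c' := fun q => by omega
  set x := cornerArc v i X Y p σ τ c' a with hx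
  have hxc : x c = v (i + 1) + a • X := by simp [hx, cornerArc, hc, hcc]
  have hx1 : x 1 = v (i + 1) + b • Y := by simp [hx, cornerArc, hc'.symm, hb]
  have hxp : x c' = p := by simp [hx, cornerArc]
  have hmc : x c ∈ edge v e := (h.mem_left _).2 ⟨a, ha0.le, ha1.le, hxc⟩
  have hm1 : x 1 ∈ edge v e' := (h.mem_right _).2 ⟨b, hb0.le, hb1.le, hx1⟩
  have hmp : x c' ∈ edge v k := hxp ▸ hp.mem
  have hmem : ∀ q, x q ∈ edge v (if q = c' then k else if q = 1 then e' else e) := by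
    intro q
    rcases hex q with rfl | rfl | rfl
    · simpa [hc, hcc] using hmc
    · simpa [hc'.symm] using hm1
    · simpa using hmp
  have hvert : ∀ q l, x q ≠ v l := by
    intro q l
    rcases hex q with rfl | rfl | rfl
    · rw [hxc]
      exact h.interior_left a ha0 ha1 l
    · rw [hx1]
      exact h.interior_right b hb0 hb1 l
    · rw [hxp]
      exact hp.ne_vertex hn hv h l
  refine ⟨hmem, (mem_trisecants_iff hn hv).2 ⟨fun q => mem_curve.2 ⟨_, hmem q⟩, ?_, ?_⟩⟩
  -- None of the points is a vertex, so each lies on a single edge, and `e`, `e'`, `k` are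
  -- different.
  · intro q q' hqq j hj hj'
    have h1 := eq_of_mem_edge_of_ne hn hv (hmem q) hj (hvert q)
    have h2 := eq_of_mem_edge_of_ne hn hv (hmem q') hj' (hvert q')
    rw [← h2] at h1
    have he := h.ne
    have hk := hp.ne_edge h
    have v1 : (if c = c' then k else if c = 1 then e' else e) = e := by simp [hc, hcc]
    have v2 : (if (1 : Fin 3) = c' then k else if (1 : Fin 3) = 1 then e' else e) = e' := by
      simp [hc'.symm]
    have v3 : (if c' = c' then k else if c' = 1 then e' else e) = k := by simp
    rcases hex q with hq | hq | hq <;> rcases hex q' with hq' | hq' | hq' <;>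
      rw [hq, hq'] at h1 hqq <;>
      first
        | exact hqq rfl
        | rw [v1, v2] at h1; exact he h1
        | rw [v1, v3] at h1; exact hk.1 h1.symm
        | rw [v2, v1] at h1; exact he h1.symm
        | rw [v2, v3] at h1; exact hk.2 h1.symm
        | rw [v3, v1] at h1; exact hk.1 h1
        | rw [v3, v2] at h1; exact hk.2 h1
  · have hw : Wbtw ℝ (x c) (x 1) (x c') := by
      -- The parameter at which the coefficient of `X`, running from `a` to `σ`, vanishes.
      refine ⟨a / (a - σ), ⟨by positivity, by rw [div_le_one haσ]; linarith⟩, ?_⟩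
      rw [AffineMap.lineMap_apply_module, hxc, hx1, hxp, hp.eq, hb]
      match_scalars <;> field_simp <;> ring
    have : (c = 0 ∧ c' = 2) ∨ (c = 2 ∧ c' = 0) := by omega
    rcases this with ⟨rfl, rfl⟩ | ⟨rfl, rfl⟩
    · exact hw
    · exact hw.symm

/-- Near a degenerate trisecant, the trisecants lie on the arc of the corner. -/
lemma IsCorner.eventually_eq_cornerArc (hn : 4 ≤ n) (hv : IsNondegenerate v)
    (h : IsCorner v i e e' X Y) (hp : IsOutside v i X Y σ τ k p) {c c' : Fin 3} (hc : c ≠ 1)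
    (hc' : c' ≠ 1) (hcc : c ≠ c') {x : Fin 3 → E3} (hxc : x c = v (i + 1))
    (hx1 : x 1 = v (i + 1)) (hxp : x c' = p) :
    ∀ᶠ y in 𝓝 x, y ∈ trisecants (curve v) → y c' = p ∧ ∃ a b : ℝ, 0 ≤ a ∧
      y c = v (i + 1) + a • X ∧ y 1 = v (i + 1) + b • Y ∧ (a - σ) * b = τ * a := by
  have hn3 : 3 ≤ n := by omega
  have hw : ∀ᶠ y in 𝓝 (v (i + 1)), y ∈ curve v → y ∈ edge v e ∨ y ∈ edge v e' := by
    have : ∀ᶠ y in 𝓝 (v (i + 1)), ∀ q, q ≠ e → q ≠ e' → y ∉ edge v q := by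
      rw [eventually_all]
      intro q
      by_cases hq : v (i + 1) ∈ edge v q
      · rcases h.eq_or_eq q hq with rfl | rfl <;> simp
      · filter_upwards [(isClosed_edge q).isOpen_compl.mem_nhds hq] with y hy _ _ using hy
    filter_upwards [this] with y hy hyK
    obtain ⟨q, hq⟩ := mem_curve.1 hyK
    by_contra! hcon
    refine hy q ?_ ?_ hq
    · rintro rfl
      exact hcon.1 hq
    · rintro rfl
      exact hcon.2 hq
  have hpk := eventually_mem_edge hn3 hv hp.mem (hp.ne_vertex hn3 hv h)
  have e1 : ∀ᶠ y in 𝓝 x, y c ∈ curve v → y c ∈ edge v e ∨ y c ∈ edge v e' :=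
    (continuous_apply c).continuousAt.eventually (hxc.symm ▸ hw)
  have e2 : ∀ᶠ y in 𝓝 x, y 1 ∈ curve v → y 1 ∈ edge v e ∨ y 1 ∈ edge v e' :=
    (continuous_apply 1).continuousAt.eventually (hx1.symm ▸ hw)
  have e3 : ∀ᶠ y in 𝓝 x, y c' ∈ curve v → y c' ∈ edge v k :=
    (continuous_apply c').continuousAt.eventually (hxp.symm ▸ hpk)
  filter_upwards [e1, e2, e3] with y h1 h2 h3 hy
  have hne := hp.ne_edge h
  -- The third point is on the edge `k` and in the plane of the corner, which meet only in `p`.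
  have huniq : ∀ s t : ℝ, y c' = v (i + 1) + s • X + t • Y → y c' = p := by
    intro s t hst
    refine h.eq_of_mem_edge hn hv hne.1 hne.2 (h3 (hy.mem c')) hp.mem ?_ (hp.vol_eq_zero h)
    rw [hst]
    exact h.vol_eq_zero s t
  rcases h1 (hy.mem c) with hce | hce
  · have h1e : y 1 ∈ edge v e' := (h2 (hy.mem 1)).resolve_left fun h1e =>
      trisecants_not_mem_edge hy hc hce h1e
    obtain ⟨a, b, s, t, ha, -, -, h4, h5, h6, h7⟩ := h.trisecant hn3 hv hy hc hc' hcc hce h1e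
    have h8 := huniq s t h6
    have h9 : s = σ ∧ t = τ := h.coeff_eq (h6.symm.trans (h8.trans hp.eq))
    rw [h9.1, h9.2] at h7
    exact ⟨h8, a, b, ha.le, h4, h5, h7⟩
  -- If the two corner edges exchange their roles, the signs of the coordinates of `p` are exchanged
  -- too.
  · exfalso
    have h1e : y 1 ∈ edge v e := (h2 (hy.mem 1)).resolve_right fun h1e =>
      trisecants_not_mem_edge hy hc hce h1e
    obtain ⟨a, b, s, t, -, hs, ht, -, -, h6, -⟩ :=
      h.symm.trisecant hn3 hv hy hc hc' hcc hce h1e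
    rw [add_right_comm] at h6
    have h9 : t = σ ∧ s = τ := h.coeff_eq (h6.symm.trans ((huniq t s h6).trans hp.eq))
    linarith [hp.neg]

/-- Near a degenerate trisecant, the closure of the trisecants is a smooth half-open arc. -/
theorem IsCorner.halfOpenArc (hn : 4 ≤ n) (hv : IsNondegenerate v)
    (h : IsCorner v i e e' X Y) (hp : IsOutside v i X Y σ τ k p) {c c' : Fin 3} (hc : c ≠ 1)
    (hc' : c' ≠ 1) (hcc : c ≠ c') {x : Fin 3 → E3} (hxc : x c = v (i + 1))
    (hx1 : x 1 = v (i + 1)) (hxp : x c' = p) :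
    x ∈ trisecantClosure (curve v) ∧ ∃ γ : ℝ → Fin 3 → E3, γ 0 = x ∧
      Topology.IsEmbedding ((Set.Ico (0 : ℝ) 1).domRestrict γ) ∧
      (∃ U, IsOpen U ∧ γ '' Set.Ico (0 : ℝ) 1 = trisecantClosure (curve v) ∩ U) ∧
      IsSmoothPiece (cubes v) γ (Set.Ico (0 : ℝ) 1) := by
  have hn3 : 3 ≤ n := by omega
  have hσ := hp.neg
  have hτ := hp.pos
  have hex : ∀ q, q = c ∨ q = 1 ∨ q = c' := fun q => by omega
  set γ := cornerArc v i X Y p σ τ c' with hγ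
  have hγc : ∀ a, γ a c = v (i + 1) + a • X := fun a => by simp [hγ, cornerArc, hc, hcc]
  have hγ1 : ∀ a, γ a 1 = v (i + 1) + (τ * a / (a - σ)) • Y := fun a => by
    simp [hγ, cornerArc, hc'.symm]
  have hγp : ∀ a, γ a c' = p := fun a => by simp [hγ, cornerArc]
  have hγ0 : γ 0 = x := by
    funext q
    rcases hex q with rfl | rfl | rfl
    · simp [hγc, hxc]
    · simp [hγ1, hx1]
    · rw [hγp, hxp]
  have hX0 : X ≠ 0 := by
    rintro rfl
    have := h.indep 1 0 (by simp)
    norm_num at this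
  obtain ⟨φ, hφ⟩ := SeparatingDual.exists_eq_one (R := ℝ) hX0
  have hφγ : ∀ a, φ (γ a c - v (i + 1)) = a := fun a => by
    rw [hγc, add_sub_cancel_left, map_smul, hφ, smul_eq_mul, mul_one]
  have hsm := contDiffOn_cornerArc (v := v) (i := i) (X := X) (Y := Y) (p := p) (σ := σ) (τ := τ) c'
  have hγcont : ContinuousAt γ 0 := hsm.continuousOn.continuousAt (Ioi_mem_nhds hσ)
  obtain ⟨U₀, hU₀, hU₀o, hxU₀⟩ :=
    eventually_nhds_iff.1 (h.eventually_eq_cornerArc hn hv hp hc hc' hcc hxc hx1 hxp)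
  obtain ⟨r₀, hr₀, hr₀'⟩ := Metric.eventually_nhds_iff.1
    (hγcont.eventually_mem (hU₀o.mem_nhds (by rwa [hγ0])))
  -- The three bounds keep the arc in `U₀`, its outer point on `e` and its middle point on `e'`.
  set r := min r₀ (min 1 (-σ / τ)) with hr
  have hr0 : 0 < r := lt_min hr₀ (lt_min one_pos (div_pos (by linarith) hτ))
  have hr1 : r ≤ 1 := (min_le_right _ _).trans (min_le_left _ _)
  have hr2 : r ≤ -σ / τ := (min_le_right _ _).trans (min_le_right _ _)
  have hT : ∀ a, 0 < a → a < r →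
      (∀ q, γ a q ∈ edge v (if q = c' then k else if q = 1 then e' else e)) ∧
        γ a ∈ trisecants (curve v) := by
    intro a ha har
    refine cornerArc_mem_trisecants hn3 hv h hp hc hc' hcc ha (har.trans_le hr1) ?_
    have := (lt_div_iff₀ hτ).1 (har.trans_le hr2)
    linarith
  have hxM : x ∈ trisecantClosure (curve v) := by
    refine mem_closure_of_tendsto (f := γ) (b := 𝓝[>] 0) ?_ ?_
    · rw [← hγ0]
      exact hγcont.tendsto.mono_left nhdsWithin_le_nhds
    · filter_upwards [Ioo_mem_nhdsGT hr0] with a ha using (hT a ha.1 ha.2).2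
  have hγM : ∀ a ∈ Set.Ico 0 r, γ a ∈ trisecantClosure (curve v) := by
    intro a ha
    rcases ha.1.eq_or_lt with rfl | h0
    · rwa [hγ0]
    · exact subset_closure (hT a h0 ha.2).2
  have hγU : ∀ a ∈ Set.Ico 0 r, γ a ∈ U₀ := by
    intro a ha
    refine hr₀' ?_
    rw [Real.dist_eq, sub_zero, abs_of_nonneg ha.1]
    exact ha.2.trans_le (min_le_left _ _)
  -- The equations of the arc with the denominator cleared and the parameter read off by `φ`. They
  -- define a closed set, so they pass from the trisecants in `U₀` to the closure.
  let Z : Set (Fin 3 → E3) := {y | 0 ≤ φ (y c - v (i + 1))} ∩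
    ({y | y c = v (i + 1) + φ (y c - v (i + 1)) • X} ∩
    ({y | (φ (y c - v (i + 1)) - σ) • (y 1 - v (i + 1)) = (τ * φ (y c - v (i + 1))) • Y} ∩
      {y | y c' = p}))
  have hZ : IsClosed Z := by
    refine IsClosed.inter (isClosed_le ?_ ?_) (IsClosed.inter (isClosed_eq ?_ ?_)
      (IsClosed.inter (isClosed_eq ?_ ?_) (isClosed_eq ?_ ?_))) <;> fun_prop
  have hTZ : U₀ ∩ trisecants (curve v) ⊆ Z := by
    rintro y ⟨hyU, hyT⟩
    obtain ⟨h1, a, b, ha, h2, h3, h4⟩ := hU₀ y hyU hyT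
    have h5 : φ (y c - v (i + 1)) = a := by
      rw [h2, add_sub_cancel_left, map_smul, hφ, smul_eq_mul, mul_one]
    refine ⟨by rwa [Set.mem_ofPred_eq, h5], by rwa [Set.mem_ofPred_eq, h5], ?_, h1⟩
    rw [Set.mem_ofPred_eq, h5, h3, add_sub_cancel_left, smul_smul, h4]
  have hMZ : ∀ y ∈ trisecantClosure (curve v), y ∈ U₀ → y ∈ Z := fun y hyM hyU =>
    closure_minimal hTZ hZ (hU₀o.inter_closure ⟨hyU, hyM⟩)
  have main := exists_halfOpenArc (cells := cubes v) (M := trisecantClosure (curve v)) (γ := γ)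
    hr0 (φ.comp (ContinuousLinearMap.proj c)) ?_ ?_ ?_ ?_
  · refine ⟨hxM, ?_⟩
    rwa [hγ0] at main
  · intro t _
    simp [hγc, hφ]
  · refine ⟨U₀ ∩ {y | φ (y c - v (i + 1)) < r}, hU₀o.inter
      (isOpen_lt (by fun_prop) (by fun_prop)), ?_⟩
    ext y
    constructor
    · rintro ⟨t, ht, rfl⟩
      exact ⟨hγM t ht, hγU t ht, by simpa only [Set.mem_ofPred_eq, hφγ] using ht.2⟩
    · rintro ⟨hyM, hyU, hyr⟩
      obtain ⟨h1, h2, h3, h4⟩ := hMZ y hyM hyU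
      refine ⟨φ (y c - v (i + 1)), ⟨h1, hyr⟩, ?_⟩
      have h5 : φ (y c - v (i + 1)) - σ ≠ 0 := (sub_pos.2 (hσ.trans_le h1)).ne'
      funext q
      rcases hex q with rfl | rfl | rfl
      · rw [hγc, ← h2]
      · rw [hγ1, div_eq_inv_mul, mul_smul, ← h3, smul_smul, inv_mul_cancel₀ h5, one_smul,
          add_sub_cancel]
      · rw [hγp, h4]
  · exact hsm.mono fun t ht => hσ.trans_le ht.1
  · refine ⟨_, ⟨fun q => if q = c' then k else if q = 1 then e' else e, rfl⟩, ?_⟩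
    intro t ht q
    rcases ht.1.eq_or_lt with rfl | h0
    · rw [hγ0]
      rcases hex q with rfl | rfl | rfl
      · simpa [hc, hcc, hxc] using (h.mem_left _).2 ⟨0, le_rfl, zero_le_one, by simp⟩
      · simpa [hc'.symm, hx1] using (h.mem_right _).2 ⟨0, le_rfl, zero_le_one, by simp⟩
      · simpa [hxp] using hp.mem
    · exact (hT t h0 ht.2).1 q

end Arc

end Corners

/-! ### Limits of trisecants are degenerate -/

section Degenerate

variable {n : ℕ} [NeZero n] {v : Fin n → E3}

lemma mem_oscPlane {i : Fin n} {p : E3} :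
    p ∈ oscPlane v (i + 1) ↔ ∃ s t : ℝ,
      p = v (i + 1) + s • (v i - v (i + 1)) + t • (v (i + 1 + 1) - v (i + 1)) := by
  have hw : v (i + 1) ∈ ({v i, v (i + 1), v (i + 1 + 1)} : Set E3) := by simp
  have hw' := subset_affineSpan ℝ _ hw
  rw [oscPlane, add_sub_cancel_right, ← AffineSubspace.vsub_right_mem_direction_iff_mem hw',
    direction_affineSpan, vectorSpan_eq_span_vsub_set_right ℝ hw]
  have himg : (fun y => y -ᵥ v (i + 1)) '' ({v i, v (i + 1), v (i + 1 + 1)} : Set E3) =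
      insert 0 {v i - v (i + 1), v (i + 1 + 1) - v (i + 1)} := by
    simp [Set.image_insert_eq, Set.insert_comm]
  rw [himg, Submodule.span_insert_zero, Submodule.mem_span_pair, vsub_eq_sub]
  constructor
  · rintro ⟨s, t, h⟩
    exact ⟨s, t, by rw [add_assoc, h, add_sub_cancel]⟩
  · rintro ⟨s, t, h⟩
    exact ⟨s, t, by rw [h]; abel⟩

/-- The line through a vertex and a point of its osculating plane leaves the double wedge if and
only if the point is not in the double wedge. -/
lemma line_subset_doubleWedge_iff (hn : 3 ≤ n) (hv : IsNondegenerate v) {i : Fin n} {p : E3}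
    {s t : ℝ} (hp : p = v (i + 1) + s • (v i - v (i + 1)) + t • (v (i + 1 + 1) - v (i + 1))) :
    ((line[ℝ, p, v (i + 1)] : AffineSubspace ℝ E3) : Set E3) ⊆ doubleWedge v (i + 1) ↔
      0 ≤ s * t := by
  constructor
  · intro h
    obtain ⟨s', t', hst, h'⟩ := h (left_mem_affineSpan_pair ℝ p (v (i + 1)))
    rw [add_sub_cancel_right] at h'
    have := (isCorner hn hv i).coeff_eq (hp.symm.trans h')
    rwa [this.1, this.2]
  · intro hst y hy
    obtain ⟨r, rfl⟩ := mem_affineSpan_pair_iff_exists_lineMap_eq.1 hy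
    -- Moving along a line through the vertex multiplies the product of the coordinates by a square.
    refine ⟨(1 - r) * s, (1 - r) * t, ?_, ?_⟩
    · nlinarith [mul_nonneg (sq_nonneg (1 - r)) hst]
    · rw [add_sub_cancel_right, AffineMap.lineMap_apply_module, hp]
      module

/-- The degenerate trisecants in terms of corners. -/
lemma mem_degenerateTrisecants_iff (hn : 3 ≤ n) (hv : IsNondegenerate v) {x : Fin 3 → E3} :
    x ∈ degenerateTrisecants v ↔ ∃ (i e e' k : Fin n) (X Y : E3) (σ τ : ℝ) (c c' : Fin 3),
      IsCorner v i e e' X Y ∧ IsOutside v i X Y σ τ k (x c') ∧ c ≠ 1 ∧ c' ≠ 1 ∧ c ≠ c' ∧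
        x c = v (i + 1) ∧ x 1 = v (i + 1) := by
  constructor
  · rintro ⟨i, p, hpK, hpo, hline, hx⟩
    obtain ⟨i, rfl⟩ : ∃ j, i = j + 1 := ⟨i - 1, by simp⟩
    obtain ⟨s, t, hst⟩ := mem_oscPlane.1 hpo
    rw [line_subset_doubleWedge_iff hn hv hst, not_le] at hline
    obtain ⟨k, hk⟩ := mem_curve.1 hpK
    obtain ⟨c, c', hc, hc', hcc, hxc, hx1, hxp⟩ : ∃ c c' : Fin 3, c ≠ 1 ∧ c' ≠ 1 ∧ c ≠ c' ∧
        x c = v (i + 1) ∧ x 1 = v (i + 1) ∧ x c' = p := by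
      rcases hx with rfl | rfl
      · exact ⟨0, 2, by decide, by decide, by decide, rfl, rfl, rfl⟩
      · exact ⟨2, 0, by decide, by decide, by decide, rfl, rfl, rfl⟩
    -- The complement of the double wedge has two sectors; they correspond to the two orders of the
    -- corner edges.
    rcases mul_neg_iff.1 hline with ⟨hs, ht⟩ | ⟨hs, ht⟩
    · refine ⟨i, _, _, k, _, _, t, s, c, c', (isCorner hn hv i).symm, ⟨ht, hs, hxp ▸ hk, ?_⟩,
        hc, hc', hcc, hxc, hx1⟩
      rw [hxp, hst, add_right_comm (v (i + 1))]
    · exact ⟨i, _, _, k, _, _, s, t, c, c', isCorner hn hv i, ⟨hs, ht, hxp ▸ hk, hxp ▸ hst⟩,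
        hc, hc', hcc, hxc, hx1⟩
  · rintro ⟨i, e, e', k, X, Y, σ, τ, c, c', h, hp, hc, hc', hcc, hxc, hx1⟩
    have hστ : σ * τ < 0 := mul_neg_of_neg_of_pos hp.neg hp.pos
    obtain ⟨s, t, hst, hp'⟩ : ∃ s t : ℝ, s * t < 0 ∧
        x c' = v (i + 1) + s • (v i - v (i + 1)) + t • (v (i + 1 + 1) - v (i + 1)) := by
      rcases h.directions with ⟨hX, hY⟩ | ⟨hY, hX⟩
      · exact ⟨σ, τ, hστ, by rw [hp.eq, hX, hY]⟩
      · exact ⟨τ, σ, by linarith, by rw [hp.eq, hX, hY, add_right_comm (v (i + 1))]⟩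
    refine ⟨i + 1, x c', mem_curve.2 ⟨k, hp.mem⟩, mem_oscPlane.2 ⟨s, t, hp'⟩, ?_, ?_⟩
    · rw [line_subset_doubleWedge_iff hn hv hp']
      exact not_le.2 hst
    · have : (c = 0 ∧ c' = 2) ∨ (c = 2 ∧ c' = 0) := by omega
      rcases this with ⟨rfl, rfl⟩ | ⟨rfl, rfl⟩
      · left
        funext q
        fin_cases q <;> simp [hxc, hx1]
      · right
        funext q
        fin_cases q <;> simp [hxc, hx1]

/-- The points of the closure of the set of trisecants that are not trisecants are degenerate. -/
lemma mem_degenerateTrisecants_of_mem_closure (hn : 4 ≤ n) (hv : IsNondegenerate v)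
    {x : Fin 3 → E3} (hx : x ∈ trisecantClosure (curve v)) (hxT : x ∉ trisecants (curve v)) :
    x ∈ degenerateTrisecants v := by
  have hn3 : 3 ≤ n := by omega
  -- There are finitely many cubes, so `x` is a limit of trisecants from a single one.
  let T : (Fin 3 → Fin n) → Set (Fin 3 → E3) := fun f =>
    {y | y ∈ trisecants (curve v) ∧ ∀ a, y a ∈ edge v (f a)}
  obtain ⟨f, hf⟩ : ∃ f, x ∈ closure (T f) := by
    have : trisecants (curve v) = ⋃ f, T f := by
      ext y
      rw [Set.mem_iUnion]
      constructor
      · intro hy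
        obtain ⟨f, hf⟩ := trisecants_mem_cube hy
        exact ⟨f, hy, hf⟩
      · rintro ⟨f, hy, -⟩
        exact hy
    rw [trisecantClosure, this, closure_iUnion_of_finite, Set.mem_iUnion] at hx
    exact hx
  have hclosed : ∀ {C : Set (Fin 3 → E3)}, IsClosed C → T f ⊆ C → x ∈ C := fun hC hTC =>
    closure_minimal hTC hC hf
  obtain ⟨y, hyT, hyf⟩ : (T f).Nonempty := closure_nonempty_iff.1 ⟨x, hf⟩
  have hxf : ∀ a, x a ∈ edge v (f a) := fun a =>
    hclosed ((isClosed_edge (f a)).preimage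
      (by fun_prop : Continuous fun z : Fin 3 → E3 => z a)) fun z hz => hz.2 a
  have hxw : Wbtw ℝ (x 0) (x 1) (x 2) := hclosed (isClosed_wbtw 0 1 2) fun z hz =>
    wbtw_of_mem_trisecants hn3 hv hz.1 (by decide) (by decide) (by decide)
  have hfne : ∀ {a b}, a ≠ b → f a ≠ f b := fun {a b} hab h =>
    trisecants_not_mem_edge hyT hab (hyf a) (h ▸ hyf b)
  by_cases hmid : ∃ c c' : Fin 3, c ≠ 1 ∧ c' ≠ 1 ∧ c ≠ c' ∧ x c = x 1
  · obtain ⟨c, c', hc, hc', hcc, hxc⟩ := hmid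
    obtain ⟨i, X, Y, h, hw⟩ := exists_isCorner hn3 hv (hfne hc) (hxc ▸ hxf c) (hxf 1)
    have hz : ∀ z ∈ T f, ∃ σ τ : ℝ, σ < 0 ∧ 0 < τ ∧ z c' = v (i + 1) + σ • X + τ • Y := by
      intro z hz
      obtain ⟨a, b, σ, τ, -, hσ, hτ, -, -, h3, -⟩ :=
        h.trisecant hn3 hv hz.1 hc hc' hcc (hz.2 c) (hz.2 1)
      exact ⟨σ, τ, hσ, hτ, h3⟩
    obtain ⟨σ, τ, hσ, hτ, hy'⟩ := hz y ⟨hyT, hyf⟩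
    -- All trisecants of this cube have the same third point, the one where the edge `f c'` meets
    -- the plane of the corner; so the limit has it as well.
    have hxy : x c' = y c' := by
      refine hclosed (isClosed_eq (f := fun z : Fin 3 → E3 => z c') (g := fun _ => y c')
        (by fun_prop) (by fun_prop)) fun z hzT => ?_
      obtain ⟨σ', τ', -, -, hz'⟩ := hz z hzT
      refine h.eq_of_mem_edge hn hv (hfne hcc.symm) (hfne hc') (hzT.2 c') (hyf c') ?_ ?_
      · rw [hz']
        exact h.vol_eq_zero _ _
      · rw [hy']
        exact h.vol_eq_zero _ _
    exact (mem_degenerateTrisecants_iff hn3 hv).2 ⟨i, f c, f 1, f c', X, Y, σ, τ, c, c', h,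
      ⟨hσ, hτ, hxf c', hxy.trans hy'⟩, hc, hc', hcc, hxc.trans hw, hw⟩
  -- Now the points of the limit are distinct, and `x` can fail to be a trisecant only because two
  -- of them share an edge `i`.
  · exfalso
    have h01 : x 0 ≠ x 1 := fun h => hmid ⟨0, 2, by decide, by decide, by decide, h⟩
    have h21 : x 2 ≠ x 1 := fun h => hmid ⟨2, 0, by decide, by decide, by decide, h⟩
    have h02 : x 0 ≠ x 2 := by
      intro h
      rw [← h] at hxw
      exact h01 ((wbtw_self_iff ℝ).1 hxw).symm
    have hne : ∀ a b, a ≠ b → x a ≠ x b := by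
      intro a b hab
      fin_cases a <;> fin_cases b <;> first | exact absurd rfl hab | assumption | (symm; assumption)
    have hcol : Collinear ℝ (Set.range x) := by
      have hr : Set.range x = {x 0, x 1, x 2} := by
        ext z
        simp [Fin.exists_fin_succ, eq_comm]
      rw [hr]
      exact hxw.collinear
    obtain ⟨a, b, hab, i, ha, hb⟩ : ∃ a b, a ≠ b ∧ ∃ i, x a ∈ edge v i ∧ x b ∈ edge v i := by
      by_contra! hcon
      exact hxT ((mem_trisecants_iff hn3 hv).2
        ⟨fun a => mem_curve.2 ⟨_, hxf a⟩, fun a b hab i h1 h2 => hcon a b hab i h1 h2, hxw⟩)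
    -- By collinearity the third point is on the line of `i`; if its own edge is another one, it is
    -- an endpoint of `i`.
    have hall : ∀ c, x c ∈ edge v i := by
      intro c
      obtain ⟨r, hr⟩ := exists_eq_add_smul_of_collinear hcol (hne a b hab) c
      obtain ⟨s, -, -, hs⟩ := mem_edge.1 ha
      obtain ⟨t, -, -, ht⟩ := mem_edge.1 hb
      have hc : x c = pt v i (s + r * (t - s)) := by
        rw [sub_eq_iff_eq_add.1 hr, hs, ht, pt, pt, pt]
        module
      obtain ⟨u, -, -, hu⟩ := mem_edge.1 (hxf c)
      by_cases hi : f c = i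
      · exact hi ▸ hxf c
      · rcases pt_eq_pt hn3 hv hi (hu.symm.trans hc) with ⟨-, -, h⟩ | ⟨-, -, h⟩
        · rw [hc, h, pt_zero]
          exact left_mem_edge i
        · rw [hc, h, pt_one]
          exact right_mem_edge i
    have hend : ∀ c, f c ≠ i → (f c = i + 1 ∧ x c = pt v i 1) ∨ (i = f c + 1 ∧ x c = pt v i 0) := by
      intro c hc
      obtain ⟨s, -, -, hs⟩ := mem_edge.1 (hall c)
      obtain ⟨u, -, -, hu⟩ := mem_edge.1 (hxf c)
      rcases pt_eq_pt hn3 hv hc.symm (hs.symm.trans hu) with ⟨h, h', -⟩ | ⟨h, h', -⟩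
      · exact Or.inl ⟨h, h' ▸ hs⟩
      · exact Or.inr ⟨h, h' ▸ hs⟩
    -- The middle point is strictly between two points of the edge `i`, so it is not an endpoint and
    -- lies on no other edge.
    have hf1 : f 1 = i := by
      by_contra hf1
      obtain ⟨s, hs0, hs1, hs⟩ := mem_edge.1 (hall 0)
      obtain ⟨t, ht0, ht1, ht⟩ := mem_edge.1 (hall 2)
      obtain ⟨r, ⟨hr0, hr1⟩, hr⟩ := hxw
      have hx1 : x 1 = pt v i ((1 - r) * s + r * t) := by
        rw [← hr, AffineMap.lineMap_apply_module, hs, ht, pt, pt, pt]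
        module
      have hr0' : 0 < r := lt_of_le_of_ne hr0 (by rintro rfl; exact h01 (by simpa using hr))
      have hr1' : r < 1 := lt_of_le_of_ne hr1 (by rintro rfl; exact h21 (by simpa using hr))
      have hst : s ≠ t := by
        rintro rfl
        exact h02 (hs.trans ht.symm)
      rcases hend 1 hf1 with ⟨-, h⟩ | ⟨-, h⟩
      · have := pt_injective hn3 hv (hx1.symm.trans h)
        have h1 : (1 - r) * (1 - s) + r * (1 - t) = 0 := by linear_combination -this
        have h2 := mul_nonneg (sub_nonneg.2 hr1) (sub_nonneg.2 hs1)
        have h3 := mul_nonneg hr0 (sub_nonneg.2 ht1)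
        have h4 := (mul_eq_zero.1 (by linarith : (1 - r) * (1 - s) = 0)).resolve_left (by linarith)
        have h5 := (mul_eq_zero.1 (by linarith : r * (1 - t) = 0)).resolve_left hr0'.ne'
        exact hst (by linarith)
      · have := pt_injective hn3 hv (hx1.symm.trans h)
        have h2 := mul_nonneg (sub_nonneg.2 hr1) hs0
        have h3 := mul_nonneg hr0 ht0
        have h4 := (mul_eq_zero.1 (by linarith : (1 - r) * s = 0)).resolve_left (by linarith)
        have h5 := (mul_eq_zero.1 (by linarith : r * t = 0)).resolve_left hr0'.ne'
        exact hst (by linarith)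
    -- The outer edges would be the two neighbours of `i`, but the trisecant `y` of the same cube
    -- cannot meet three consecutive edges.
    have hadj : ∀ {a b : Fin 3}, a ≠ 1 → b ≠ 1 → a ≠ b → i = f a + 1 → f b ≠ i + 1 := by
      intro a b ha hb hab hia hib
      have h1 := apart_of_adjacent hn hv hyT ha hab hb.symm (hyf a)
        (by rw [← hia, ← hf1]; exact hyf 1) (hyf b)
      rw [← hia, hib] at h1
      exact h1.2.2.1 rfl
    have hf0 : f 0 ≠ i := hf1 ▸ hfne (by decide)
    have hf2 : f 2 ≠ i := hf1 ▸ hfne (by decide)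
    rcases hend 0 hf0 with ⟨h0, h0'⟩ | ⟨h0, h0'⟩ <;> rcases hend 2 hf2 with ⟨h2, h2'⟩ | ⟨h2, h2'⟩
    · exact h02 (h0'.trans h2'.symm)
    · exact hadj (a := 2) (b := 0) (by decide) (by decide) (by decide) h2 h0
    · exact hadj (a := 0) (b := 2) (by decide) (by decide) (by decide) h0 h2
    · exact h02 (h0'.trans h2'.symm)

/-- The boundary of the set of trisecants of a polygon with at least four vertices. -/
lemma trisecantBoundary_eq (hn : 4 ≤ n) (hv : IsNondegenerate v) :
    trisecantBoundary (curve v) = degenerateTrisecants v := by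
  have hn3 : 3 ≤ n := by omega
  ext x
  refine ⟨fun hx => mem_degenerateTrisecants_of_mem_closure hn hv hx.1 hx.2, fun hx => ?_⟩
  obtain ⟨i, e, e', k, X, Y, σ, τ, c, c', h, hp, hc, hc', hcc, hxc, hx1⟩ :=
    (mem_degenerateTrisecants_iff hn3 hv).1 hx
  exact ⟨(h.halfOpenArc hn hv hp hc hc' hcc hxc hx1 rfl).1, fun hxT =>
    trisecants_ne hxT hc (hxc.trans hx1.symm)⟩

lemma degenerateTrisecants_subset : degenerateTrisecants v ⊆ bigDiagonal (curve v) := by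
  have hvK : ∀ i, v i ∈ curve v := fun i => mem_curve.2 ⟨i, left_mem_edge i⟩
  rintro x ⟨i, p, hp, -, -, rfl | rfl⟩
  · refine ⟨fun q => ?_, 0, 1, by decide, rfl⟩
    fin_cases q <;> simp [hvK, hp]
  · refine ⟨fun q => ?_, 1, 2, by decide, rfl⟩
    fin_cases q <;> simp [hvK, hp]

/-! ### Triangles -/

/-- A triangle lies in the closed sector at each of its vertices, which leaves no point outside the
double wedge. -/
lemma triangle_edge_subset (hn : n = 3) (i k : Fin n) {p : E3} (hp : p ∈ edge v k) :
    ∃ s t : ℝ, 0 ≤ s ∧ 0 ≤ t ∧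
      p = v (i + 1) + s • (v i - v (i + 1)) + t • (v (i + 1 + 1) - v (i + 1)) := by
  obtain ⟨t, h0, h1, rfl⟩ := mem_edge.1 hp
  have hk : k = i ∨ k = i + 1 ∨ (k = i + 1 + 1 ∧ k + 1 = i) := by
    subst hn
    omega
  rcases hk with rfl | rfl | ⟨rfl, h⟩
  · exact ⟨1 - t, 0, by linarith, le_rfl, by rw [pt]; module⟩
  · exact ⟨0, t, le_rfl, h0, by rw [pt]; module⟩
  · exact ⟨t, 1 - t, h0, by linarith, by rw [pt, h]; module⟩

lemma IsCorner.not_isOutside_of_triangle (hn : n = 3) {i e e' k : Fin n} {X Y p : E3} {σ τ : ℝ}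
    (h : IsCorner v i e e' X Y) : ¬ IsOutside v i X Y σ τ k p := by
  intro hp
  obtain ⟨s, t, hs, ht, hst⟩ := triangle_edge_subset hn i k hp.mem
  rcases h.directions with ⟨hX, hY⟩ | ⟨hY, hX⟩
  · rw [← hX, ← hY, hp.eq] at hst
    linarith [(h.coeff_eq hst).1, hp.neg]
  · rw [← hX, ← hY, hp.eq, add_right_comm (v (i + 1)) (s • Y)] at hst
    linarith [(h.coeff_eq hst).1, hp.neg]

lemma degenerateTrisecants_triangle (hn : n = 3) (hv : IsNondegenerate v) :
    degenerateTrisecants v = ∅ := by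
  rw [Set.eq_empty_iff_forall_notMem]
  intro x hx
  obtain ⟨i, e, e', k, X, Y, σ, τ, c, c', h, hp, -⟩ :=
    (mem_degenerateTrisecants_iff hn.ge hv).1 hx
  exact h.not_isOutside_of_triangle hn hp

/-- Any two edges of a triangle form a corner, so the third point of a trisecant would have to lie
outside its double wedge. -/
lemma trisecants_triangle (hn : n = 3) (hv : IsNondegenerate v) :
    trisecants (curve v) = ∅ := by
  rw [Set.eq_empty_iff_forall_notMem]
  intro x hx
  obtain ⟨f, hf⟩ := trisecants_mem_cube hx
  have hne : f 0 ≠ f 1 := fun h =>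
    trisecants_not_mem_edge hx (a := 0) (b := 1) (by decide) (hf 0) (h ▸ hf 1)
  obtain ⟨l, h0, h1⟩ : ∃ l, v l ∈ edge v (f 0) ∧ v l ∈ edge v (f 1) := by
    have : f 1 = f 0 + 1 ∨ f 0 = f 1 + 1 := by
      subst hn
      omega
    rcases this with h | h
    · exact ⟨f 0 + 1, right_mem_edge _, h ▸ left_mem_edge _⟩
    · exact ⟨f 1 + 1, h ▸ left_mem_edge _, right_mem_edge _⟩
  obtain ⟨i, X, Y, h, -⟩ := exists_isCorner hn.ge hv hne h0 h1
  obtain ⟨a, b, σ, τ, -, hσ, hτ, -, -, h3, -⟩ := h.trisecant hn.ge hv hx (c := 0) (c' := 2)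
    (by decide) (by decide) (by decide) (hf 0) (hf 1)
  exact h.not_isOutside_of_triangle hn ⟨hσ, hτ, hf 2, h3⟩

end Degenerate

/-! ### Compactness and the assembly of the local pictures -/

section Main

variable {n : ℕ} [NeZero n] {v : Fin n → E3}

open Filter Topology

lemma isClosed_bigDiagonal : IsClosed (bigDiagonal (curve v)) := by
  have : bigDiagonal (curve v) = (⋂ i, {x | x i ∈ curve v}) ∩
      ⋃ (i : Fin 3) (j : Fin 3) (_ : i ≠ j), {x : Fin 3 → E3 | x i = x j} := by
    ext x
    simp [bigDiagonal, cube]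
  rw [this]
  refine IsClosed.inter (isClosed_iInter fun i => ?_) (isClosed_iUnion_of_finite fun i =>
    isClosed_iUnion_of_finite fun j => isClosed_iUnion_of_finite fun _ => ?_)
  · exact isCompact_curve.isClosed.preimage (continuous_apply i)
  · exact isClosed_eq (by fun_prop) (by fun_prop)

lemma isCompact_cube : IsCompact (cube (curve v)) := by
  have : cube (curve v) = Set.univ.pi fun _ : Fin 3 => curve v := by
    ext x
    simp [cube]
  rw [this]
  exact isCompact_univ_pi fun _ => isCompact_curve

lemma isCompact_trisecantClosure : IsCompact (trisecantClosure (curve v)) :=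
  isCompact_cube.of_isClosed_subset isClosed_closure
    (closure_minimal (fun _ hx => hx.mem) isCompact_cube.isClosed)

lemma trisecantBoundary_eq_degenerateTrisecants (hn : 3 ≤ n) (hv : IsNondegenerate v) :
    trisecantBoundary (curve v) = degenerateTrisecants v := by
  rcases hn.eq_or_lt with h | h
  · rw [degenerateTrisecants_triangle h.symm hv, trisecantBoundary, trisecantClosure,
      trisecants_triangle h.symm hv, closure_empty, Set.empty_sdiff]
  · exact trisecantBoundary_eq h hv

lemma isPiecewiseSmoothCurve_trisecantClosure (hn : 3 ≤ n) (hv : IsNondegenerate v) :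
    IsPiecewiseSmoothCurve (cubes v) (trisecantClosure (curve v))
      (trisecantBoundary (curve v)) := by
  rcases hn.eq_or_lt with h | h
  · have hM : trisecantClosure (curve v) = ∅ := by
      rw [trisecantClosure, trisecants_triangle h.symm hv, closure_empty]
    have hB : trisecantBoundary (curve v) = ∅ := by
      rw [trisecantBoundary, hM, Set.empty_sdiff]
    rw [hM, hB]
    exact ⟨le_rfl, fun x hx => hx.1.elim, fun x hx => hx.elim⟩
  have hdeg := trisecantBoundary_eq_degenerateTrisecants hn hv
  refine ⟨Set.sdiff_subset, fun x hx => ?_, fun x hx => ?_⟩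
  · have hxT : x ∈ trisecants (curve v) := by
      by_contra hxT
      exact hx.2 ⟨hx.1, hxT⟩
    refine trisecants_openArc h hv hxT ?_
    -- Points of the closure near `x` avoid the closed big diagonal, hence are not degenerate, hence
    -- are trisecants; so the description of `trisecants` near `x` also holds for the closure.
    have hxd : x ∉ bigDiagonal (curve v) := by
      rintro ⟨-, a, b, hab, hxab⟩
      exact trisecants_ne hxT hab hxab
    filter_upwards [isClosed_bigDiagonal.isOpen_compl.mem_nhds hxd] with y hy
    refine ⟨fun hyM => ?_, fun hyT => subset_closure hyT⟩
    by_contra hyT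
    have hyB : y ∈ trisecantBoundary (curve v) := ⟨hyM, hyT⟩
    rw [hdeg] at hyB
    exact hy (degenerateTrisecants_subset hyB)
  · rw [hdeg] at hx
    obtain ⟨i, e, e', k, X, Y, σ, τ, c, c', h', hp, hc, hc', hcc, hxc, hx1⟩ :=
      (mem_degenerateTrisecants_iff hn hv).1 hx
    exact (h'.halfOpenArc h hv hp hc hc' hcc hxc hx1 rfl).2

end Main

end PolyKnot

end

theorem mainTheorem7 {n : ℕ} [NeZero n] (hn : 3 ≤ n) (v : Fin n → PolyKnot.E3)
    (hv : PolyKnot.IsGeneric v) :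
    IsCompact (PolyKnot.trisecantClosure (PolyKnot.curve v)) ∧
    (∃ _ : ChartedSpace (EuclideanHalfSpace 1) ↥(PolyKnot.trisecantClosure (PolyKnot.curve v)),
      (𝓡∂ 1).boundary ↥(PolyKnot.trisecantClosure (PolyKnot.curve v)) =
        Subtype.val ⁻¹' PolyKnot.trisecantBoundary (PolyKnot.curve v)) ∧
    PolyKnot.IsPiecewiseSmoothCurve (PolyKnot.cubes v)
      (PolyKnot.trisecantClosure (PolyKnot.curve v))
      (PolyKnot.trisecantBoundary (PolyKnot.curve v)) ∧
    PolyKnot.trisecants (PolyKnot.curve v) ⊆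
      PolyKnot.cube (PolyKnot.curve v) \ PolyKnot.fatDiagonal (PolyKnot.curve v) ∧
    PolyKnot.trisecantBoundary (PolyKnot.curve v) ⊆ PolyKnot.bigDiagonal (PolyKnot.curve v) ∧
    PolyKnot.trisecantBoundary (PolyKnot.curve v) = PolyKnot.degenerateTrisecants v := by
  have hv' := hv.toIsNondegenerate
  have hcurve := PolyKnot.isPiecewiseSmoothCurve_trisecantClosure hn hv'
  have hdeg := PolyKnot.trisecantBoundary_eq_degenerateTrisecants hn hv'
  refine ⟨PolyKnot.isCompact_trisecantClosure, hcurve.exists_chartedSpace, hcurve, ?_, ?_, hdeg⟩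
  · rintro x hx
    refine ⟨hx.mem, ?_⟩
    rintro ⟨-, a, b, hab, hs⟩
    exact hx.not_straight a b hab hs
  · rw [hdeg]
    exact PolyKnot.degenerateTrisecants_subset
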